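/- Let $n\in\mathbb N_0$ and $\mu\in\mathbb R$. Let $\mathcal D$ be the space of all $(u_0,u_1)\in L^2(\mathbb R^n)\times H^{-1}(\mathbb R^n)$ with $0\notin\operatorname{supp}\widehat u_0$ and $0\notin\operatorname{supp}\widehat u_1$. Then there is a linear map $W:(u_0,u_1)\mapsto(w_0,w_1)$ from $\mathcal D$ to $L^2(\mathbb R^n)\times H^{-1}(\mathbb R^n)$ with the following property. For every $\varepsilon>0$ there is a constant $C=C(n,\mu,\varepsilon)$ such that, for all $(u_0,u_1)\in\mathcal D$ with $|\xi|\ge\varepsilon$ for every $\xi\in\operatorname{supp}\widehat u_0\cup\operatorname{supp}\widehat u_1$, and with $(w_0,w_1)=W(u_0,u_1)$: (i) $\|w_0\|_{L^2}+\|w_1\|_{H^{-1}}\le C\,\big(\|u_0\|_{L^2}+\|u_1\|_{H^{-1}}\big)$, that is, $W$ is bounded on $L^2\times H^{-1}$ as long as the Fourier supports keep a fixed distance from $0$; (ii) there is a free wave $w\in C^2(\mathbb R;\mathscr S'(\mathbb R^n))$, that is, a solution of $$w_{tt}-\Delta w=0,\qquad w(1,\cdot)=w_0,\quad w_t(1,\cdot)=w_1,$$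 such that every solution $u\in C^2([1,\infty);\mathscr S'(\mathbb R^n))$ of the weakly damped wave equation $$u_{tt}-\Delta u+\frac{2\mu}{t}u_t=0,\qquad u(1,\cdot)=u_0,\quad u_t(1,\cdot)=u_1,$$ satisfies, for all $t\ge1$, $$\|t^\mu u(t,\cdot)-w(t,\cdot)\|_{L^2}\le C\,t^{-1}\big(\|u_0\|_{L^2}+\|u_1\|_{H^{-1}}\big).$$ -/

import Mathlib

open MeasureTheory FourierTransform
open scoped SchwartzMap Laplacian ENNReal NNReal

noncomputable section

namespace WeakDamping

/-- The Euclidean space `ℝⁿ`. -/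
abbrev Space (n : ℕ) : Type := EuclideanSpace ℝ (Fin n)

/-- The `L²` norm of a tempered distribution, equal to `∞` if it is not an `L²` function. -/
def l2Norm {n : ℕ} (f : 𝓢'(Space n, ℂ)) : ℝ≥0∞ :=
  ⨅ (g : Lp ℂ 2 (volume : Measure (Space n))) (_ : f = Lp.toTemperedDistribution g), ‖g‖ₑ

/-- The norm of the Sobolev (Bessel potential) space `H ^ s = H ^ {s, 2}` of a tempered
distribution, equal to `∞` if it does not belong to this space. It uses the weight
`(1 + |ξ| ^ 2) ^ (s / 2)` in the frequency variable of the Fourier transform with kernel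
`exp (-2 π i x · ξ)`; the weight `(1 + 4 π ^ 2 |ξ| ^ 2) ^ (s / 2)` yields an equivalent norm. -/
def sobolevNorm {n : ℕ} (s : ℝ) (f : 𝓢'(Space n, ℂ)) : ℝ≥0∞ :=
  l2Norm (TemperedDistribution.besselPotential (Space n) ℂ s f)

/-- The support of the Fourier transform of a tempered distribution. -/
def fourierSupport {n : ℕ} (f : 𝓢'(Space n, ℂ)) : Set (Space n) :=
  Distribution.dsupport (𝓕 f : 𝓢'(Space n, ℂ))

theorem zero_notMem_fourierSupport_zero {n : ℕ} :
    (0 : Space n) ∉ fourierSupport (0 : 𝓢'(Space n, ℂ)) := by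
  rw [fourierSupport, Distribution.notMem_dsupport_iff]
  exact ⟨Set.univ, fun φ _ => by simp, isOpen_univ, trivial⟩

theorem zero_notMem_fourierSupport_add {n : ℕ} {f g : 𝓢'(Space n, ℂ)}
    (hf : 0 ∉ fourierSupport f) (hg : 0 ∉ fourierSupport g) : 0 ∉ fourierSupport (f + g) := by
  rw [fourierSupport, Distribution.notMem_dsupport_iff] at hf hg ⊢
  obtain ⟨s, hs, hso, h0s⟩ := hf
  obtain ⟨r, hr, hro, h0r⟩ := hg
  refine ⟨s ∩ r, fun φ hφ => ?_, hso.inter hro, h0s, h0r⟩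
  have h1 : f (𝓕 φ) = 0 := hs φ (hφ.trans Set.inter_subset_left)
  have h2 : g (𝓕 φ) = 0 := hr φ (hφ.trans Set.inter_subset_right)
  change f (𝓕 φ) + g (𝓕 φ) = 0
  rw [h1, h2, add_zero]

theorem zero_notMem_fourierSupport_smul {n : ℕ} (c : ℂ) {f : 𝓢'(Space n, ℂ)}
    (hf : 0 ∉ fourierSupport f) : 0 ∉ fourierSupport (c • f) := by
  rw [fourierSupport, Distribution.notMem_dsupport_iff] at hf ⊢
  obtain ⟨s, hs, hso, h0s⟩ := hf
  refine ⟨s, fun φ hφ => ?_, hso, h0s⟩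
  have h1 : f (𝓕 φ) = 0 := hs φ hφ
  change c • f (𝓕 φ) = 0
  rw [h1, smul_zero]

/-- The Cauchy data `(u₀, u₁) ∈ L² × H⁻¹` such that `0` belongs neither to the support of the
Fourier transform of `u₀` nor to that of `u₁`. -/
def admissibleData (n : ℕ) : Submodule ℂ (𝓢'(Space n, ℂ) × 𝓢'(Space n, ℂ)) where
  carrier := {d | (TemperedDistribution.MemSobolev 0 2 d.1 ∧
      TemperedDistribution.MemSobolev (-1) 2 d.2) ∧
      (0 ∉ fourierSupport d.1 ∧ 0 ∉ fourierSupport d.2)}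
  zero_mem' := ⟨⟨TemperedDistribution.memSobolev_fun_zero _ _ 0 2,
      TemperedDistribution.memSobolev_fun_zero _ _ (-1) 2⟩,
    zero_notMem_fourierSupport_zero, zero_notMem_fourierSupport_zero⟩
  add_mem' := fun ha hb => ⟨⟨ha.1.1.add hb.1.1, ha.1.2.add hb.1.2⟩,
    zero_notMem_fourierSupport_add ha.2.1 hb.2.1, zero_notMem_fourierSupport_add ha.2.2 hb.2.2⟩
  smul_mem' := fun c _ ha => ⟨⟨ha.1.1.smul c, ha.1.2.smul c⟩,
    zero_notMem_fourierSupport_smul c ha.2.1, zero_notMem_fourierSupport_smul c ha.2.2⟩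

/-- `u ∈ C²(I; 𝓢'(ℝⁿ))` solves the Cauchy problem
`u_tt - Δ u + b(t) u_t = 0` for `t ∈ I`, `u(1) = u₀`, `u_t(1) = u₁`.

Differentiability and continuity in `𝓢'(ℝⁿ)` are tested by pairing with each Schwartz function;
at an end point of `I` the derivatives are one-sided. -/
def SolvesCauchyProblem {n : ℕ} (b : ℝ → ℝ) (I : Set ℝ) (u : ℝ → 𝓢'(Space n, ℂ))
    (u₀ u₁ : 𝓢'(Space n, ℂ)) : Prop :=
  ∃ ut utt : ℝ → 𝓢'(Space n, ℂ),
    (∀ φ : 𝓢(Space n, ℂ), ∀ t ∈ I, HasDerivWithinAt (fun s => u s φ) (ut t φ) I t) ∧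
    (∀ φ : 𝓢(Space n, ℂ), ∀ t ∈ I, HasDerivWithinAt (fun s => ut s φ) (utt t φ) I t) ∧
    (∀ φ : 𝓢(Space n, ℂ), ContinuousOn (fun s => utt s φ) I) ∧
    (∀ t ∈ I, utt t - Δ (u t) + (b t : ℂ) • ut t = 0) ∧
    u 1 = u₀ ∧ ut 1 = u₁

end WeakDamping

end

noncomputable section

/-!
The Fourier transform turns the damped wave equation into the oscillators
`y'' + (2μ/t) y' + k² y = 0`, where `k = 2π‖ξ‖`. Liouville's transformation `y(t) = t^(-μ) f(k t)`
removes the damping and leaves `f'' + (1 + (μ - μ²)/x²) f = 0`. This equation has a Jost solution,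
one with `f(x) = e^(ix) + O(1/x)` as `x → ∞`. For `‖ξ‖` bounded below, `t^μ y(t) = f(k t)` and the
free mode `e^(ikt)` therefore differ by `O(1/t)`, uniformly in `ξ`. Because the Wronskian of `f`
and its conjugate is constant, the real oscillations with initial data `(1, 0)` and `(0, 1)` are the
real parts of explicit multiples of the damped mode. The free wave `w` has the same amplitudes as
`u`, and `W` sends the data of `u` to the data of `w` at time `1`.

Every solution `u` is this superposition of modes, because the Cauchy problem has at most one
solution in `𝓢'`. Indeed, by Banach-Steinhaus the difference of two solutions is, locally
uniformly in time, bounded by one Schwartz norm. On test functions supported in a fixed ball,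
multiplication by `k²` is bounded in that norm, so the oscillator equation is an ordinary
differential equation with bounded coefficients and the difference vanishes there. Compactly
supported functions are dense in `𝓢`.
-/

namespace WeakDamping

open Filter Topology
open scoped BoundedContinuousFunction

section SchwartzSpace

variable {E F : Type*} [NormedAddCommGroup E] [NormedSpace ℝ E]

section Complete

variable [NormedAddCommGroup F] [NormedSpace ℝ F] [CompleteSpace F]

theorem exists_schwartzMap_eq_tsum (f : ℕ → 𝓢(E, F))
    (hf : ∀ k l, Summable fun j => SchwartzMap.seminorm ℝ k l (f j)) :
    ∃ g : 𝓢(E, F), (∀ x, g x = ∑' j, f j x) ∧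
      ∀ k l, SchwartzMap.seminorm ℝ k l g ≤ ∑' j, SchwartzMap.seminorm ℝ k l (f j) := by
  have hbound (l j : ℕ) (x : E) :
      ‖iteratedFDeriv ℝ l (f j) x‖ ≤ SchwartzMap.seminorm ℝ 0 l (f j) :=
    SchwartzMap.norm_iteratedFDeriv_le_seminorm ℝ (f j) l x
  have hsmooth (j : ℕ) : ContDiff ℝ ((⊤ : ℕ∞) : WithTop ℕ∞) (f j) := (f j).smooth ⊤
  have hdecay (k l : ℕ) (x : E) : ‖x‖ ^ k * ‖iteratedFDeriv ℝ l (fun x => ∑' j, f j x) x‖ ≤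
      ∑' j, SchwartzMap.seminorm ℝ k l (f j) := by
    have hs : Summable fun j => ‖iteratedFDeriv ℝ l (f j) x‖ :=
      .of_nonneg_of_le (fun _ => norm_nonneg _) (fun j => hbound l j x) (hf 0 l)
    rw [iteratedFDeriv_tsum_apply hsmooth (fun k _ => hf 0 k) (fun l j x _ => hbound l j x)
      le_top x]
    calc ‖x‖ ^ k * ‖∑' j, iteratedFDeriv ℝ l (f j) x‖
        ≤ ‖x‖ ^ k * ∑' j, ‖iteratedFDeriv ℝ l (f j) x‖ := by
          gcongr
          exact norm_tsum_le_tsum_norm hs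
      _ = ∑' j, ‖x‖ ^ k * ‖iteratedFDeriv ℝ l (f j) x‖ := tsum_mul_left.symm
      _ ≤ _ := (hs.mul_left _).tsum_le_tsum (fun j => SchwartzMap.le_seminorm ℝ k l (f j) x)
          (hf k l)
  refine ⟨⟨fun x => ∑' j, f j x, contDiff_tsum hsmooth (fun k _ => hf 0 k)
    (fun l j x _ => hbound l j x), fun k l => ⟨_, hdecay k l⟩⟩, fun x => rfl, fun k l => ?_⟩
  exact SchwartzMap.seminorm_le_bound ℝ k l _ (tsum_nonneg fun j => apply_nonneg _ _)
    (hdecay k l)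

theorem exists_tendsto_sum_schwartzMap (f : ℕ → 𝓢(E, F))
    (hf : ∀ k l, Summable fun j => SchwartzMap.seminorm ℝ k l (f j)) :
    ∃ g : 𝓢(E, F), Tendsto (fun n => ∑ j ∈ Finset.range n, f j) atTop (𝓝 g) := by
  obtain ⟨g, hg, -⟩ := exists_schwartzMap_eq_tsum f hf
  refine ⟨g, ?_⟩
  rw [(schwartz_withSeminorms ℝ E F).tendsto_nhds]
  rintro ⟨k, l⟩ ε hε
  have htail := tendsto_sum_nat_add fun j => SchwartzMap.seminorm ℝ k l (f j)
  filter_upwards [htail.eventually (gt_mem_nhds hε)] with n hn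
  obtain ⟨r, hr, hrn⟩ := exists_schwartzMap_eq_tsum (fun j => f (j + n))
    fun k l => (summable_nat_add_iff n).2 (hf k l)
  have hrg : ∑ j ∈ Finset.range n, f j - g = -r := by
    ext x
    have hx : Summable fun j => f j x :=
      .of_norm_bounded (hf 0 0) fun j => SchwartzMap.norm_le_seminorm ℝ (f j) x
    simp [hg, hr, ← hx.sum_add_tsum_nat_add n]
  change SchwartzMap.seminorm ℝ k l _ < ε
  rw [hrg, map_neg_eq_map]
  exact (hrn k l).trans_lt hn

instance completeSpace_schwartzMap : CompleteSpace 𝓢(E, F) := by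
  have : (uniformity 𝓢(E, F)).IsCountablyGenerated :=
    IsUniformAddGroup.uniformity_countably_generated
  let V (N : ℕ) : Set 𝓢(E, F) :=
    {f | ∀ i ∈ Finset.Iic (N, N), schwartzSeminormFamily ℝ E F i f < (1 / 2) ^ N}
  have hV (N : ℕ) : V N ∈ 𝓝 (0 : 𝓢(E, F)) := by
    refine (Finset.eventually_all _).2 fun i _ => ?_
    have hc := ((schwartz_withSeminorms ℝ E F).continuous_seminorm i).tendsto 0
    rw [map_zero] at hc
    exact hc.eventually (gt_mem_nhds (by positivity))
  refine UniformSpace.complete_of_convergent_controlled_sequences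
    (fun N => {p | p.2 - p.1 ∈ V N}) (fun N => ?_) fun u hu => ?_
  · rw [uniformity_eq_comap_nhds_zero]
    exact preimage_mem_comap (hV N)
  · have hs (k l : ℕ) : Summable fun j => SchwartzMap.seminorm ℝ k l (u (j + 1) - u j) := by
      refine (summable_nat_add_iff (max k l)).1 ?_
      refine .of_nonneg_of_le (fun _ => apply_nonneg _ _) (fun j => ?_)
        ((summable_nat_add_iff (max k l)).2 summable_geometric_two)
      have hkl : (k, l) ∈ Finset.Iic (j + max k l, j + max k l) := by
        simp only [Finset.mem_Iic, Prod.mk_le_mk]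
        constructor <;> lia
      exact (hu (j + max k l) (j + max k l) (j + max k l + 1) le_rfl (by lia) _ hkl).le
    obtain ⟨g, hg⟩ := exists_tendsto_sum_schwartzMap _ hs
    refine ⟨g + u 0, ?_⟩
    simp_rw [Finset.sum_range_sub] at hg
    simpa using hg.add_const (u 0)

end Complete

variable (E F) in
/-- The Schwartz norm of order `N`: the largest of the seminorms `sup ‖x‖ ^ k ‖D ^ l φ(x)‖` with
`k, l ≤ N`. -/
def schwartzNorm [NormedAddCommGroup F] [NormedSpace ℝ F] (N : ℕ) : Seminorm ℝ 𝓢(E, F) :=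
  (Finset.Iic (N, N)).sup (schwartzSeminormFamily ℝ E F)

theorem seminorm_le_schwartzNorm [NormedAddCommGroup F] [NormedSpace ℝ F] {k l N : ℕ}
    (hk : k ≤ N) (hl : l ≤ N) (φ : 𝓢(E, F)) :
    SchwartzMap.seminorm ℝ k l φ ≤ schwartzNorm E F N φ :=
  Finset.le_sup (f := schwartzSeminormFamily ℝ E F)
    (Finset.mem_Iic.2 (show (k, l) ≤ (N, N) from ⟨hk, hl⟩)) φ

variable [NormedAddCommGroup F] [NormedSpace ℂ F]

theorem exists_norm_le_schwartzNorm [CompleteSpace F] {ι G : Type*} [NormedAddCommGroup G]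
    [NormedSpace ℝ G] (T : ι → 𝓢(E, F) →L[ℝ] G) (hT : ∀ φ, ∃ C : ℝ, ∀ i, ‖T i φ‖ ≤ C) :
    ∃ (N : ℕ) (A : ℝ), 0 ≤ A ∧ ∀ i φ, ‖T i φ‖ ≤ A * schwartzNorm E F N φ := by
  have : (uniformity 𝓢(E, F)).IsCountablyGenerated :=
    IsUniformAddGroup.uniformity_countably_generated
  have : BaireSpace 𝓢(E, F) := inferInstance
  have : BarrelledSpace ℝ 𝓢(E, F) := BaireSpace.instBarrelledSpace
  have hequi : UniformEquicontinuous ((↑) ∘ T : ι → 𝓢(E, F) → G) := by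
    refine (norm_withSeminorms ℝ G).banach_steinhaus fun _ φ => ?_
    obtain ⟨C, hC⟩ := hT φ
    exact ⟨C, by rintro _ ⟨i, rfl⟩; exact hC i⟩
  obtain ⟨p, hp, hTp⟩ :=
    ((norm_withSeminorms ℝ G).uniformEquicontinuous_iff_exists_continuous_seminorm
      fun i => (T i : 𝓢(E, F) →ₗ[ℝ] G)).1 hequi 0
  obtain ⟨s, C, -, hC⟩ := Seminorm.bound_of_continuous (schwartz_withSeminorms ℝ E F) p hp
  let N := s.sup fun i => max i.1 i.2
  have hs : s ⊆ Finset.Iic (N, N) := fun i hi => by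
    have h := Finset.le_sup (f := fun i : ℕ × ℕ => max i.1 i.2) hi
    exact Finset.mem_Iic.2 ⟨(le_max_left _ _).trans h, (le_max_right _ _).trans h⟩
  refine ⟨N, C, C.2, fun i φ => (hTp i φ).trans ((hC φ).trans ?_)⟩
  exact mul_le_mul_of_nonneg_left (Finset.sup_mono (f := schwartzSeminormFamily ℝ E F) hs φ) C.2

theorem seminorm_smulLeftCLM_le {g : E → ℂ} (hg : g.HasTemperateGrowth) (φ : 𝓢(E, F)) {B : ℝ}
    (hB : 0 ≤ B) (j k l : ℕ)
    (hgB : ∀ i ≤ l, ∀ x ∈ tsupport φ, ‖iteratedFDeriv ℝ i g x‖ ≤ B * ‖x‖ ^ j) :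
    SchwartzMap.seminorm ℝ k l (SchwartzMap.smulLeftCLM F g φ) ≤
      B * ∑ i ∈ Finset.range (l + 1), l.choose i * SchwartzMap.seminorm ℝ (k + j) (l - i) φ := by
  refine SchwartzMap.seminorm_le_bound ℝ k l _ (mul_nonneg hB <| Finset.sum_nonneg fun i _ =>
    mul_nonneg (Nat.cast_nonneg _) (apply_nonneg _ _)) fun x => ?_
  have hleibniz := norm_iteratedFDeriv_smul_le (hg.1.of_le (by exact_mod_cast le_top))
    (φ.smooth l) x (n := l) le_rfl
  rw [show ⇑(SchwartzMap.smulLeftCLM F g φ) = fun x => g x • φ x from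
    funext (SchwartzMap.smulLeftCLM_apply_apply hg φ), Finset.mul_sum]
  refine (mul_le_mul_of_nonneg_left hleibniz (by positivity)).trans ?_
  rw [Finset.mul_sum]
  refine Finset.sum_le_sum fun i hi => ?_
  by_cases hx : x ∈ tsupport φ
  · calc ‖x‖ ^ k * (l.choose i * ‖iteratedFDeriv ℝ i g x‖ * ‖iteratedFDeriv ℝ (l - i) φ x‖)
        ≤ ‖x‖ ^ k * (l.choose i * (B * ‖x‖ ^ j) * ‖iteratedFDeriv ℝ (l - i) φ x‖) := by
          gcongr
          exact hgB i (Finset.mem_range_succ_iff.1 hi) x hx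
      _ = B * (l.choose i * (‖x‖ ^ (k + j) * ‖iteratedFDeriv ℝ (l - i) φ x‖)) := by ring
      _ ≤ _ := by
          gcongr
          exact SchwartzMap.le_seminorm ℝ (k + j) (l - i) φ x
  · have h0 : iteratedFDeriv ℝ (l - i) φ x = 0 := by
      by_contra h
      exact hx (support_iteratedFDeriv_subset (𝕜 := ℝ) (l - i) h)
    rw [h0, norm_zero, mul_zero, mul_zero]
    exact mul_nonneg hB (mul_nonneg (Nat.cast_nonneg _) (apply_nonneg _ _))

theorem exists_schwartzNorm_smulLeftCLM_le [ProperSpace E] {g : E → ℂ}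
    (hg : g.HasTemperateGrowth) (R : ℝ) (N : ℕ) :
    ∃ K : ℝ, 0 ≤ K ∧ ∀ φ : 𝓢(E, F), tsupport φ ⊆ Metric.closedBall 0 R →
      schwartzNorm E F N (SchwartzMap.smulLeftCLM F g φ) ≤ K * schwartzNorm E F N φ := by
  have hcont : Continuous fun x => ∑ i ∈ Finset.range (N + 1), ‖iteratedFDeriv ℝ i g x‖ :=
    continuous_finsetSum _ fun i _ =>
      (hg.1.continuous_iteratedFDeriv (m := i) (by exact_mod_cast le_top)).norm
  obtain ⟨B, hB⟩ := (isCompact_closedBall (0 : E) R).exists_bound_of_continuousOn hcont.continuousOn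
  have hderiv (i : ℕ) (hi : i ≤ N) (x : E) (hx : x ∈ Metric.closedBall 0 R) :
      ‖iteratedFDeriv ℝ i g x‖ ≤ |B| * ‖x‖ ^ 0 := by
    rw [pow_zero, mul_one]
    exact (Finset.single_le_sum (f := fun i => ‖iteratedFDeriv ℝ i g x‖)
      (fun i _ => norm_nonneg _) (Finset.mem_range_succ_iff.2 hi)).trans
      ((le_abs_self _).trans ((hB x hx).trans (le_abs_self B)))
  refine ⟨|B| * 2 ^ N, by positivity, fun φ hφ => ?_⟩
  refine Seminorm.finset_sup_apply_le (by positivity) ?_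
  rintro ⟨k, l⟩ hkl
  obtain ⟨hk, hl⟩ : k ≤ N ∧ l ≤ N := Finset.mem_Iic.1 hkl
  calc SchwartzMap.seminorm ℝ k l (SchwartzMap.smulLeftCLM F g φ)
      ≤ |B| * ∑ i ∈ Finset.range (l + 1), l.choose i * SchwartzMap.seminorm ℝ k (l - i) φ :=
        seminorm_smulLeftCLM_le hg φ (abs_nonneg B) 0 k l
          fun i hi x hx => hderiv i (hi.trans hl) x (hφ hx)
    _ ≤ |B| * ∑ i ∈ Finset.range (l + 1), l.choose i * schwartzNorm E F N φ := by
        gcongr with i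
        exact seminorm_le_schwartzNorm hk (by lia) φ
    _ = |B| * (2 ^ l * schwartzNorm E F N φ) := by
        rw [← Finset.sum_mul]
        exact_mod_cast congrArg (fun m : ℕ => |B| * ((m : ℝ) * schwartzNorm E F N φ))
          (Nat.sum_range_choose l)
    _ ≤ |B| * (2 ^ N * schwartzNorm E F N φ) := by
        gcongr
        exact one_le_two
    _ = _ := by ring

theorem norm_iteratedFDeriv_comp_smul_le {g : E → F} {i : ℕ} (hg : ContDiff ℝ i g) {B r : ℝ}
    (hB : ∀ x, ‖iteratedFDeriv ℝ i g x‖ ≤ B * ‖x‖) (hr₀ : 0 ≤ r) (hr₁ : r ≤ 1) (x : E) :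
    ‖iteratedFDeriv ℝ i (fun x => g (r • x)) x‖ ≤ B * r * ‖x‖ ^ 1 := by
  rw [iteratedFDeriv_comp_const_smul r hg, norm_smul, norm_pow, Real.norm_of_nonneg hr₀]
  calc r ^ i * ‖iteratedFDeriv ℝ i g (r • x)‖ ≤ ‖iteratedFDeriv ℝ i g (r • x)‖ :=
        mul_le_of_le_one_left (norm_nonneg _) (pow_le_one₀ hr₀ hr₁)
    _ ≤ B * (r * ‖x‖) := by simpa [norm_smul, abs_of_nonneg hr₀] using hB (r • x)
    _ = _ := by ring

section Density

variable [FiniteDimensional ℝ E] [HasContDiffBump E]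

/-- Since `1 - χ` vanishes near `0`, each of its bounded derivatives is `O(‖x‖)`: this is what
makes the scaled error `(1 - χ (r x)) φ` of order `r`. -/
theorem exists_norm_iteratedFDeriv_one_sub_bump_le (χ : ContDiffBump (0 : E)) (i : ℕ) :
    ∃ B, 0 ≤ B ∧ ∀ x, ‖iteratedFDeriv ℝ i (fun x => 1 - (χ x : ℂ)) x‖ ≤ B * ‖x‖ := by
  have hsupp : HasCompactSupport fun x => (χ x : ℂ) :=
    χ.hasCompactSupport.comp_left (g := Complex.ofReal) Complex.ofReal_zero
  have hsmooth (m : ℕ∞) : ContDiff ℝ m fun x => (χ x : ℂ) :=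
    Complex.ofRealCLM.contDiff.comp χ.contDiff
  let C := 1 + SchwartzMap.seminorm ℝ 0 i (hsupp.toSchwartzMap (hsmooth ⊤))
  have hC : 0 ≤ C := add_nonneg zero_le_one (apply_nonneg _ _)
  have hbound (x : E) : ‖iteratedFDeriv ℝ i (fun x => 1 - (χ x : ℂ)) x‖ ≤ C := by
    have hsub := iteratedFDeriv_sub_apply (𝕜 := ℝ) (i := i) (x := x) (f := fun _ : E => (1 : ℂ))
      contDiffAt_const (hsmooth i).contDiffAt
    refine (congrArg norm hsub).trans_le ((norm_sub_le _ _).trans (add_le_add ?_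
      (SchwartzMap.norm_iteratedFDeriv_le_seminorm ℝ (hsupp.toSchwartzMap (hsmooth ⊤)) i x)))
    rcases eq_or_ne i 0 with rfl | hi
    · simp
    · simp [iteratedFDeriv_const_of_ne hi]
  refine ⟨C / χ.rIn, div_nonneg hC χ.rIn_pos.le, fun x => ?_⟩
  rcases lt_or_ge ‖x‖ χ.rIn with hx | hx
  · have h0 : (fun x => 1 - (χ x : ℂ)) =ᶠ[𝓝 x] fun _ => 0 := by
      filter_upwards [Metric.isOpen_ball.mem_nhds (mem_ball_zero_iff.2 hx)] with z hz
      simp [χ.one_of_mem_closedBall (Metric.ball_subset_closedBall hz)]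
    rw [(h0.iteratedFDeriv ℝ i).eq_of_nhds, iteratedFDeriv_fun_zero, Pi.zero_apply, norm_zero]
    exact mul_nonneg (div_nonneg hC χ.rIn_pos.le) (norm_nonneg x)
  · refine (hbound x).trans ?_
    rw [div_mul_eq_mul_div, le_div_iff₀ χ.rIn_pos]
    exact mul_le_mul_of_nonneg_left hx hC

theorem dense_hasCompactSupport_schwartzMap :
    Dense {φ : 𝓢(E, F) | HasCompactSupport φ} := by
  intro φ
  let χ : ContDiffBump (0 : E) := ⟨1, 2, one_pos, one_lt_two⟩
  let r (m : ℕ) : ℝ := 1 / (m + 1)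
  have hr (m : ℕ) : 0 < r m := by positivity
  let χr (m : ℕ) (x : E) : ℂ := χ (r m • x)
  have hsupp (m : ℕ) : HasCompactSupport (χr m) :=
    (χ.hasCompactSupport.comp_left (g := Complex.ofReal) Complex.ofReal_zero).comp_homeomorph
      (Homeomorph.smulOfNeZero (r m) (hr m).ne')
  have hχ : ContDiff ℝ ((⊤ : ℕ∞) : WithTop ℕ∞) fun x => (χ x : ℂ) :=
    Complex.ofRealCLM.contDiff.comp χ.contDiff
  have hgrowth (m : ℕ) : (χr m).HasTemperateGrowth :=
    ((hsupp m).toSchwartzMap (hχ.comp (contDiff_const_smul _))).hasTemperateGrowth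
  refine mem_closure_of_tendsto (b := atTop) (f := fun m => SchwartzMap.smulLeftCLM F (χr m) φ) ?_
    (.of_forall fun m => ?_)
  · rw [(schwartz_withSeminorms ℝ E F).tendsto_nhds]
    rintro ⟨k, l⟩ ε hε
    choose B hB₀ hB using exists_norm_iteratedFDeriv_one_sub_bump_le χ
    let A := ∑ i ∈ Finset.range (l + 1), B i
    let S := ∑ i ∈ Finset.range (l + 1), l.choose i * SchwartzMap.seminorm ℝ (k + 1) (l - i) φ
    have hA : 0 ≤ A := Finset.sum_nonneg fun i _ => hB₀ i
    have hlim : Tendsto (fun m => A * r m * S) atTop (𝓝 0) := by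
      simpa [r] using (tendsto_one_div_add_atTop_nhds_zero_nat.const_mul A).mul_const S
    filter_upwards [hlim.eventually (gt_mem_nhds hε)] with m hm
    have hr₁ : r m ≤ 1 := div_le_one_of_le₀ (by linarith [m.cast_nonneg (α := ℝ)]) (by positivity)
    have herror : SchwartzMap.smulLeftCLM F (χr m) φ - φ =
        -SchwartzMap.smulLeftCLM F (fun x => 1 - χr m x) φ := by
      ext x
      rw [neg_apply, SchwartzMap.smulLeftCLM_apply_apply (by fun_prop)]
      simp [SchwartzMap.smulLeftCLM_apply_apply (hgrowth m), sub_smul]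
    change SchwartzMap.seminorm ℝ k l _ < ε
    rw [herror, map_neg_eq_map]
    refine (seminorm_smulLeftCLM_le (by fun_prop) φ (mul_nonneg hA (hr m).le) 1 k l
      fun i hi x _ => ?_).trans_lt hm
    refine (norm_iteratedFDeriv_comp_smul_le (g := fun x => 1 - (χ x : ℂ))
      ((contDiff_const.sub hχ).of_le (by exact_mod_cast le_top)) (hB i) (hr m).le hr₁ x).trans ?_
    have := Finset.single_le_sum (fun i _ => hB₀ i) (Finset.mem_range_succ_iff.2 hi)
    gcongr
  · exact (hsupp m).of_isClosed_subset (isClosed_tsupport _)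
      ((SchwartzMap.tsupport_smulLeftCLM_subset _ _).trans Set.inter_subset_right)

end Density

end SchwartzSpace

section Uniqueness

/-- The exponential weight `exp (Λ (t - a))` with `Λ = 2 (B + K + 1)` makes one integration in time
gain a factor `1 / 2`, however long the interval is. -/
theorem norm_le_half_mul_exp {X V : Type*} [NormedAddCommGroup V] [NormedSpace ℝ V]
    {p : X → ℝ} {M : X → X} {U U' : ℝ → X → V} {B C K a T : ℝ} (hp : ∀ φ, 0 ≤ p φ)
    (hB : 0 ≤ B) (hC : 0 ≤ C) (hM : ∀ φ, p (M φ) ≤ K * p φ)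
    (hcont : ∀ φ, ContinuousOn (fun t => U t φ) (Set.Icc a T))
    (hderiv : ∀ φ, ∀ t ∈ Set.Ico a T, HasDerivWithinAt (fun s => U s φ) (U' t φ) (Set.Ici t) t)
    (hinit : ∀ φ, U a φ = 0)
    (hgrowth : ∀ φ, ∀ t ∈ Set.Ico a T, ‖U' t φ‖ ≤ B * ‖U t φ‖ + ‖U t (M φ)‖)
    (hbound : ∀ φ, ∀ t ∈ Set.Icc a T,
      ‖U t φ‖ ≤ C * p φ * Real.exp (2 * (B + K + 1) * (t - a))) (φ : X) :
    ∀ t ∈ Set.Icc a T, ‖U t φ‖ ≤ C / 2 * p φ * Real.exp (2 * (B + K + 1) * (t - a)) := by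
  let e (t : ℝ) := Real.exp (2 * (B + K + 1) * (t - a))
  have hφ := hp φ
  have hderiv' (t : ℝ) :
      HasDerivAt (fun s => C / 2 * p φ * e s) ((B + K + 1) * (C * p φ * e t)) t := by
    refine ((((hasDerivAt_id t).sub_const a).const_mul _).exp.const_mul _).congr_deriv ?_
    simp only [e, id]
    ring
  refine image_norm_le_of_norm_deriv_right_le_deriv_boundary (hcont φ) (hderiv φ) ?_ hderiv'
    fun t ht => (hgrowth φ t ht).trans ?_
  · rw [hinit, norm_zero]
    positivity
  · have ht' := Set.Ico_subset_Icc_self ht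
    calc B * ‖U t φ‖ + ‖U t (M φ)‖
        ≤ B * (C * p φ * e t) + C * (K * p φ) * e t := by
          refine add_le_add (mul_le_mul_of_nonneg_left (hbound φ t ht') hB)
            ((hbound _ t ht').trans ?_)
          gcongr
          exact hM φ
      _ = (B + K) * (C * p φ * e t) := by ring
      _ ≤ (B + K + 1) * (C * p φ * e t) :=
          mul_le_mul_of_nonneg_right (by linarith) (by positivity)

theorem eq_zero_of_norm_deriv_le {X V : Type*} [NormedAddCommGroup V] [NormedSpace ℝ V]
    {p : X → ℝ} {M : X → X} {U U' : ℝ → X → V} {A B K a T : ℝ} (hp : ∀ φ, 0 ≤ p φ)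
    (hA : 0 ≤ A) (hB : 0 ≤ B) (hK : 0 ≤ K) (hM : ∀ φ, p (M φ) ≤ K * p φ)
    (hcont : ∀ φ, ContinuousOn (fun t => U t φ) (Set.Icc a T))
    (hderiv : ∀ φ, ∀ t ∈ Set.Ico a T, HasDerivWithinAt (fun s => U s φ) (U' t φ) (Set.Ici t) t)
    (hinit : ∀ φ, U a φ = 0)
    (hgrowth : ∀ φ, ∀ t ∈ Set.Ico a T, ‖U' t φ‖ ≤ B * ‖U t φ‖ + ‖U t (M φ)‖)
    (hbound : ∀ φ, ∀ t ∈ Set.Icc a T, ‖U t φ‖ ≤ A * p φ) (φ : X) :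
    ∀ t ∈ Set.Icc a T, U t φ = 0 := by
  have hiterate (m : ℕ) : ∀ φ, ∀ t ∈ Set.Icc a T,
      ‖U t φ‖ ≤ A / 2 ^ m * p φ * Real.exp (2 * (B + K + 1) * (t - a)) := by
    induction m with
    | zero =>
      intro φ t ht
      rw [pow_zero, div_one]
      exact (hbound φ t ht).trans (le_mul_of_one_le_right (mul_nonneg hA (hp φ))
        (Real.one_le_exp (mul_nonneg (by positivity) (sub_nonneg.2 ht.1))))
    | succ m ih =>
      rw [pow_succ, ← div_div]
      exact norm_le_half_mul_exp hp hB (by positivity) hM hcont hderiv hinit hgrowth ih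
  intro t ht
  have hlim : Tendsto (fun m : ℕ => A / 2 ^ m * p φ * Real.exp (2 * (B + K + 1) * (t - a)))
      atTop (𝓝 0) := by
    simpa using (((tendsto_pow_atTop_atTop_of_one_lt (one_lt_two (α := ℝ))).const_div_atTop
      A).mul_const (p φ)).mul_const (Real.exp (2 * (B + K + 1) * (t - a)))
  exact norm_le_zero_iff.1 (ge_of_tendsto' hlim fun m => hiterate m φ t ht)

variable {E : Type*} [NormedAddCommGroup E] [NormedSpace ℝ E]

/-- The tempered distributions `D t` solve the damped oscillator equation `D'' + b D' + g D = 0` on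
`I`, and `D₁` is the derivative of `D`. As in `SolvesCauchyProblem`, derivatives are tested by
pairing with Schwartz functions. -/
structure IsDampedOscillation (g : E → ℂ) (b : ℝ → ℝ) (I : Set ℝ) (D D₁ : ℝ → 𝓢'(E, ℂ)) :
    Prop where
  hasDerivWithinAt (φ : 𝓢(E, ℂ)) : ∀ t ∈ I, HasDerivWithinAt (fun s => D s φ) (D₁ t φ) I t
  hasDerivWithinAt_deriv (φ : 𝓢(E, ℂ)) : ∀ t ∈ I, HasDerivWithinAt (fun s => D₁ s φ)
    (-(D t (SchwartzMap.smulLeftCLM ℂ g φ) + (b t : ℂ) * D₁ t φ)) I t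

namespace IsDampedOscillation

variable {g : E → ℂ} {b : ℝ → ℝ} {I J : Set ℝ} {D D₁ G G₁ : ℝ → 𝓢'(E, ℂ)}

theorem mono (h : IsDampedOscillation g b I D D₁) (hJ : J ⊆ I) :
    IsDampedOscillation g b J D D₁ :=
  ⟨fun φ t ht => (h.1 φ t (hJ ht)).mono hJ, fun φ t ht => (h.2 φ t (hJ ht)).mono hJ⟩

theorem sub (hD : IsDampedOscillation g b I D D₁) (hG : IsDampedOscillation g b I G G₁) :
    IsDampedOscillation g b I (fun t => D t - G t) (fun t => D₁ t - G₁ t) where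
  hasDerivWithinAt φ t ht := (hD.1 φ t ht).sub (hG.1 φ t ht)
  hasDerivWithinAt_deriv φ t ht := ((hD.2 φ t ht).sub (hG.2 φ t ht)).congr_deriv <| by
    simp only [sub_apply]
    ring

theorem hasDerivWithinAt_prod (h : IsDampedOscillation g b I D D₁) (φ : 𝓢(E, ℂ)) :
    ∀ t ∈ I, HasDerivWithinAt (fun s => (D s φ, D₁ s φ))
      (D₁ t φ, -(D t (SchwartzMap.smulLeftCLM ℂ g φ) + (b t : ℂ) * D₁ t φ)) I t :=
  fun t ht => (h.1 φ t ht).prodMk (h.2 φ t ht)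

theorem exists_norm_le_schwartzNorm {a : ℝ} (h : IsDampedOscillation g b (Set.Ici a) D D₁)
    (T : ℝ) : ∃ (N : ℕ) (A : ℝ), 0 ≤ A ∧ ∀ (φ : 𝓢(E, ℂ)), ∀ t ∈ Set.Icc a T,
      ‖(D t φ, D₁ t φ)‖ ≤ A * schwartzNorm E ℂ N φ := by
  let U (t : Set.Icc a T) : 𝓢(E, ℂ) →L[ℝ] ℂ × ℂ :=
    (((D t).prod (D₁ t) : 𝓢(E, ℂ) →L[ℂ] ℂ × ℂ)).restrictScalars ℝ
  obtain ⟨N, A, hA, hU⟩ := WeakDamping.exists_norm_le_schwartzNorm U fun φ => by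
    obtain ⟨C, hC⟩ := isCompact_Icc.exists_bound_of_continuousOn (s := Set.Icc a T)
      (f := fun t => (D t φ, D₁ t φ)) fun t ht =>
        (h.hasDerivWithinAt_prod φ t ht.1).continuousWithinAt.mono Set.Icc_subset_Ici_self
    exact ⟨C, fun t => hC t t.2⟩
  exact ⟨N, A, hA, fun φ t ht => hU ⟨t, ht⟩ φ⟩

/-- On functions supported in a fixed ball, multiplication by `g` loses no derivatives, so the
equation behaves like an ordinary differential equation. -/
theorem apply_eq_zero_of_hasCompactSupport [ProperSpace E] {a : ℝ} (hg : g.HasTemperateGrowth)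
    (hb : ContinuousOn b (Set.Ici a)) (h : IsDampedOscillation g b (Set.Ici a) D D₁)
    (h₀ : D a = 0) (h₁ : D₁ a = 0) {T : ℝ} (hT : a ≤ T) {φ : 𝓢(E, ℂ)} (hφ : HasCompactSupport φ) :
    D T φ = 0 := by
  obtain ⟨R, hR⟩ := hφ.isCompact.isBounded.subset_closedBall (0 : E)
  obtain ⟨N, A, hA, hbound⟩ := h.exists_norm_le_schwartzNorm T
  obtain ⟨K, hK, hgK⟩ := exists_schwartzNorm_smulLeftCLM_le (F := ℂ) hg R N
  obtain ⟨B, hB⟩ := (isCompact_Icc (a := a) (b := T)).exists_bound_of_continuousOn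
    (hb.mono Set.Icc_subset_Ici_self)
  let X := {ψ : 𝓢(E, ℂ) // tsupport ψ ⊆ Metric.closedBall 0 R}
  let M (ψ : X) : X := ⟨SchwartzMap.smulLeftCLM ℂ g ψ,
    (SchwartzMap.tsupport_smulLeftCLM_subset _ _).trans (Set.inter_subset_left.trans ψ.2)⟩
  have hzero := eq_zero_of_norm_deriv_le (B := 1 + |B|) (M := M)
    (U := fun t (ψ : X) => (D t ψ, D₁ t ψ)) (p := fun ψ : X => schwartzNorm E ℂ N ψ)
    (fun ψ => apply_nonneg _ _) hA (by positivity) hK (fun ψ => hgK ψ ψ.2)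
    (fun ψ t ht =>
      (h.hasDerivWithinAt_prod ψ t ht.1).continuousWithinAt.mono Set.Icc_subset_Ici_self)
    (fun ψ t ht => (h.hasDerivWithinAt_prod ψ t ht.1).mono (Set.Ici_subset_Ici.2 ht.1))
    (fun ψ => by simp [h₀, h₁]) (fun ψ t ht => ?_) (fun ψ => hbound ψ) ⟨φ, hR⟩ T ⟨hT, le_rfl⟩
  · exact congrArg Prod.fst hzero
  · have hbt : ‖(b t : ℂ)‖ ≤ |B| := by
      rw [Complex.norm_real]
      exact (hB t (Set.Ico_subset_Icc_self ht)).trans (le_abs_self B)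
    have hD₁ : ‖D₁ t ψ‖ ≤ ‖(D t ψ, D₁ t ψ)‖ := norm_snd_le (D t ψ, D₁ t ψ)
    refine norm_prod_le_iff.2 ⟨?_, ?_⟩
    · nlinarith [abs_nonneg B, norm_nonneg (D t (M ψ), D₁ t (M ψ)), norm_nonneg (D t ψ, D₁ t ψ)]
    · rw [norm_neg]
      refine (norm_add_le _ _).trans ?_
      rw [norm_mul, add_comm]
      refine add_le_add ?_ (norm_fst_le (D t (M ψ), D₁ t (M ψ)))
      gcongr
      linarith

theorem eq_zero [FiniteDimensional ℝ E] [HasContDiffBump E] {a : ℝ} (hg : g.HasTemperateGrowth)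
    (hb : ContinuousOn b (Set.Ici a)) (h : IsDampedOscillation g b (Set.Ici a) D D₁)
    (h₀ : D a = 0) (h₁ : D₁ a = 0) {T : ℝ} (hT : a ≤ T) : D T = 0 := by
  have := FiniteDimensional.proper ℝ E
  have hfun : ⇑(D T) = ⇑(0 : 𝓢'(E, ℂ)) := Continuous.ext_on dense_hasCompactSupport_schwartzMap
    (D T).continuous (0 : 𝓢'(E, ℂ)).continuous
    fun φ hφ => h.apply_eq_zero_of_hasCompactSupport hg hb h₀ h₁ hT hφ
  exact DFunLike.coe_injective hfun

theorem eq_of_eq_initial [FiniteDimensional ℝ E] [HasContDiffBump E] {a : ℝ}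
    (hg : g.HasTemperateGrowth) (hb : ContinuousOn b (Set.Ici a))
    (hD : IsDampedOscillation g b (Set.Ici a) D D₁)
    (hG : IsDampedOscillation g b (Set.Ici a) G G₁) (h₀ : D a = G a) (h₁ : D₁ a = G₁ a) {T : ℝ}
    (hT : a ≤ T) : D T = G T :=
  sub_eq_zero.1 ((hD.sub hG).eq_zero hg hb (sub_eq_zero.2 h₀) (sub_eq_zero.2 h₁) hT)

end IsDampedOscillation

end Uniqueness

section LinearODE

variable {E : Type*} [NormedAddCommGroup E] [NormedSpace ℝ E] {A : ℝ → E →L[ℝ] E} {K : ℝ}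

theorem intervalIntegrable_clm_apply (hA : ContinuousOn A (Set.Ioi 0))
    (hK : ∀ s, 0 < s → ‖A s‖ ≤ K) {v : ℝ → E} (hv : Continuous v) {s : ℝ} (hs : 0 ≤ s) :
    IntervalIntegrable (fun y => A y (v y)) volume 0 s := by
  have hdom : IntervalIntegrable (fun y => K * ‖v y‖) volume 0 s :=
    Continuous.intervalIntegrable (by fun_prop) _ _
  rw [intervalIntegrable_iff_integrableOn_Ioc_of_le hs] at hdom ⊢
  refine hdom.mono' (((hA.clm_apply hv.continuousOn).mono
    Set.Ioc_subset_Ioi_self).aestronglyMeasurable measurableSet_Ioc) ?_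
  filter_upwards [ae_restrict_mem measurableSet_Ioc] with y hy
  exact (A y).le_of_opNorm_le (hK y hy.1) _

theorem norm_exp_smul_integral_le {g : ℝ → E} {C s : ℝ} (hs : 0 ≤ s)
    (hg : ∀ y, 0 < y → ‖g y‖ ≤ K * (Real.exp (2 * K * y) * C)) (hC : 0 ≤ C) :
    ‖Real.exp (-(2 * K * s)) • ∫ y in (0)..s, g y‖ ≤ 1 / 2 * C := by
  have hprim (y : ℝ) : HasDerivAt (fun y => Real.exp (2 * K * y) * C / 2)
      (K * (Real.exp (2 * K * y) * C)) y := by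
    refine ((((hasDerivAt_id y).const_mul (2 * K)).exp.mul_const C).div_const 2).congr_deriv ?_
    simp only [id]
    ring
  have hint : IntervalIntegrable (fun y => K * (Real.exp (2 * K * y) * C)) volume 0 s :=
    Continuous.intervalIntegrable (by fun_prop) _ _
  have hle : ‖∫ y in (0)..s, g y‖ ≤ Real.exp (2 * K * s) * C / 2 - C / 2 := by
    refine (intervalIntegral.norm_integral_le_of_norm_le hs
      (.of_forall fun y hy => hg y hy.1) hint).trans_eq ?_
    rw [intervalIntegral.integral_eq_sub_of_hasDerivAt (fun y _ => hprim y) hint]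
    simp
  rw [norm_smul, Real.norm_of_nonneg (Real.exp_pos _).le]
  calc Real.exp (-(2 * K * s)) * ‖∫ y in (0)..s, g y‖
      ≤ Real.exp (-(2 * K * s)) * (Real.exp (2 * K * s) * (C / 2)) := by
        gcongr
        linarith
    _ = 1 / 2 * C := by
        rw [← mul_assoc, ← Real.exp_add, neg_add_cancel, Real.exp_zero]
        ring

theorem continuous_integral_clm_apply (hA : ContinuousOn A (Set.Ioi 0))
    (hK : ∀ s, 0 < s → ‖A s‖ ≤ K) {v : ℝ → E} (hv : Continuous v) :
    Continuous fun s => ∫ y in (0)..max s 0, A y (v y) := by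
  refine continuous_iff_continuousAt.2 fun s => ?_
  have hT : 0 ≤ max s 0 + 1 := by positivity
  have hcont := intervalIntegral.continuousOn_primitive_interval'
    (intervalIntegrable_clm_apply hA hK hv hT) (a := 0) Set.left_mem_uIcc
  rw [Set.uIcc_of_le hT] at hcont
  refine ContinuousAt.congr (f := fun r => ∫ y in (0)..max (min r (s + 1)) 0, A y (v y)) ?_ ?_
  · refine (hcont.comp_continuous (by fun_prop) fun r => ⟨le_max_right _ _, ?_⟩).continuousAt
    rcases le_total s 0 with h | h <;> grind
  · filter_upwards [gt_mem_nhds (lt_add_one s)] with r hr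
    rw [min_eq_left (le_of_lt hr)]

theorem norm_clm_apply_exp_smul_le (hK : ∀ s, 0 < s → ‖A s‖ ≤ K) (g : ℝ →ᵇ E) {y : ℝ}
    (hy : 0 < y) : ‖A y (Real.exp (2 * K * y) • g y)‖ ≤ K * (Real.exp (2 * K * y) * ‖g‖) := by
  refine (A y).le_of_opNorm_le_of_le (hK y hy) ?_
  rw [norm_smul, Real.norm_of_nonneg (Real.exp_pos _).le]
  gcongr
  exact g.norm_coe_le_norm y

/-- The Picard operator of `v' = A v`, `v(0) = v₀`, for the unknown `g(s) = exp (-2 K s) v(s)`. The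
weight makes it a contraction on all of `[0, ∞)`; to the left of `0` its values are constant. -/
def weightedPicard (hA : ContinuousOn A (Set.Ioi 0)) (hK : ∀ s, 0 < s → ‖A s‖ ≤ K) (v₀ : E)
    (g : ℝ →ᵇ E) : ℝ →ᵇ E :=
  BoundedContinuousFunction.ofNormedAddCommGroup
    (fun s => Real.exp (-(2 * K * max s 0)) •
      (v₀ + ∫ y in (0)..max s 0, A y (Real.exp (2 * K * y) • g y)))
    (.smul (by fun_prop) (continuous_const.add
      (continuous_integral_clm_apply hA hK (v := fun y => Real.exp (2 * K * y) • g y)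
        (by fun_prop))))
    (‖v₀‖ + 1 / 2 * ‖g‖) fun s => by
      have hK₀ : 0 ≤ K := (norm_nonneg _).trans (hK 1 one_pos)
      rw [smul_add]
      refine (norm_add_le _ _).trans (add_le_add ?_ (norm_exp_smul_integral_le
        (le_max_right s 0) (fun y => norm_clm_apply_exp_smul_le hK g) (norm_nonneg g)))
      rw [norm_smul, Real.norm_of_nonneg (Real.exp_pos _).le]
      exact mul_le_of_le_one_left (norm_nonneg _)
        (Real.exp_le_one_iff.2 (neg_nonpos.2 (by positivity)))

theorem contractingWith_weightedPicard (hA : ContinuousOn A (Set.Ioi 0))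
    (hK : ∀ s, 0 < s → ‖A s‖ ≤ K) (v₀ : E) :
    ContractingWith (1 / 2) (weightedPicard hA hK v₀) := by
  refine ⟨by norm_num [← NNReal.coe_lt_coe], .of_dist_le_mul fun f g => ?_⟩
  rw [dist_eq_norm, dist_eq_norm]
  refine (BoundedContinuousFunction.norm_le (by positivity)).2 fun s => ?_
  have hs : (0 : ℝ) ≤ max s 0 := le_max_right s 0
  have hint (h : ℝ →ᵇ E) :=
    intervalIntegrable_clm_apply hA hK (v := fun y => Real.exp (2 * K * y) • h y) (by fun_prop) hs
  have hsub : (weightedPicard hA hK v₀ f - weightedPicard hA hK v₀ g) s =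
      Real.exp (-(2 * K * max s 0)) •
        ∫ y in (0)..max s 0, A y (Real.exp (2 * K * y) • (f - g) y) := by
    simp only [weightedPicard, BoundedContinuousFunction.sub_apply, smul_sub, map_sub,
      BoundedContinuousFunction.coe_ofNormedAddCommGroup]
    rw [← smul_sub, add_sub_add_left_eq_sub, intervalIntegral.integral_sub (hint f) (hint g)]
  rw [hsub]
  exact (norm_exp_smul_integral_le hs (fun y => norm_clm_apply_exp_smul_le hK _)
    (norm_nonneg _)).trans_eq (by norm_num)

variable [CompleteSpace E]

theorem exists_eq_add_integral (hA : ContinuousOn A (Set.Ioi 0)) (hK : ∀ s, 0 < s → ‖A s‖ ≤ K)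
    (v₀ : E) :
    ∃ v : ℝ → E, Continuous v ∧ ∀ s, 0 ≤ s → v s = v₀ + ∫ y in (0)..s, A y (v y) := by
  let hcontract := contractingWith_weightedPicard hA hK v₀
  let g := hcontract.fixedPoint
  refine ⟨fun y => Real.exp (2 * K * y) • g y, by fun_prop, fun s hs => ?_⟩
  have hg : g s = Real.exp (-(2 * K * max s 0)) •
      (v₀ + ∫ y in (0)..max s 0, A y (Real.exp (2 * K * y) • g y)) :=
    (DFunLike.congr_fun hcontract.fixedPoint_isFixedPt s).symm
  rw [max_eq_left hs] at hg
  change Real.exp (2 * K * s) • g s = _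
  rw [hg, smul_smul, ← Real.exp_add, add_neg_cancel, Real.exp_zero, one_smul]

theorem exists_hasDerivAt_clm_apply (hA : ContinuousOn A (Set.Ioi 0))
    (hK : ∀ s, 0 < s → ‖A s‖ ≤ K) (v₀ : E) :
    ∃ v : ℝ → E, Continuous v ∧ (∀ s, 0 < s → HasDerivAt v (A s (v s)) s) ∧
      ∀ S, ∃ C, ∀ s ∈ Set.Icc 0 S, ‖v s - v₀‖ ≤ C * s := by
  obtain ⟨v, hv, hint⟩ := exists_eq_add_integral hA hK v₀
  refine ⟨v, hv, fun s hs => ?_, fun S => ?_⟩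
  · have hAv := hA.clm_apply hv.continuousOn
    have hderiv := intervalIntegral.integral_hasDerivAt_right
      (intervalIntegrable_clm_apply hA hK hv hs.le)
      (hAv.stronglyMeasurableAtFilter isOpen_Ioi s hs) (hAv.continuousAt (Ioi_mem_nhds hs))
    refine (hderiv.const_add v₀).congr_of_eventuallyEq ?_
    filter_upwards [Ioi_mem_nhds hs] with r hr using hint r (le_of_lt hr)
  · obtain ⟨C, hC⟩ := (isCompact_Icc (a := 0) (b := S)).exists_bound_of_continuousOn hv.continuousOn
    refine ⟨K * C, fun s hs => ?_⟩
    rw [hint s hs.1, add_sub_cancel_left]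
    refine (intervalIntegral.norm_integral_le_of_norm_le_const (C := K * C)
      fun y hy => ?_).trans_eq (by rw [sub_zero, abs_of_nonneg hs.1])
    rw [Set.uIoc_of_le hs.1] at hy
    exact (A y).le_of_opNorm_le_of_le (hK y hy.1) (hC y ⟨hy.1.le, hy.2.trans hs.2⟩)

end LinearODE

section Jost

/-- `f`, with derivative `f'`, is the Jost solution of `f'' + (1 + c / x ^ 2) f = 0` on `(0, ∞)`:
the one that behaves like `exp (i x)` at infinity, with error `O(1 / x)` away from `x = 0`. -/
structure IsJostSolution (c : ℝ) (f f' : ℝ → ℂ) : Prop where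
  measurable : Measurable f
  measurable_deriv : Measurable f'
  hasDerivAt : ∀ x, 0 < x → HasDerivAt f (f' x) x
  hasDerivAt_deriv : ∀ x, 0 < x → HasDerivAt f' (-((1 + c / x ^ 2) * f x)) x
  exists_bound : ∀ ε, 0 < ε → ∃ C, ∀ x, ε ≤ x →
    ‖f x - Complex.exp (x * Complex.I)‖ ≤ C / x ∧
      ‖f' x - Complex.I * Complex.exp (x * Complex.I)‖ ≤ C / x

/-- The equation `f'' + (1 + c / x ^ 2) f = 0` after variation of constants
`f = a exp (i x) + b exp (-i x)`, `f' = i (a exp (i x) - b exp (-i x))` in the variable `s = 1 / x`: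
it becomes `(a, b)' = jostGenerator c s (a, b)`, with bounded coefficients up to `s = 0`. -/
def jostGenerator (c s : ℝ) : ℂ × ℂ →L[ℝ] ℂ × ℂ :=
  ((Complex.exp (s⁻¹ * Complex.I) • ContinuousLinearMap.fst ℂ ℂ ℂ +
    Complex.exp (-(s⁻¹ * Complex.I)) • ContinuousLinearMap.snd ℂ ℂ ℂ).smulRight
      ((-(Complex.I * c / 2) * Complex.exp (-(s⁻¹ * Complex.I)),
        Complex.I * c / 2 * Complex.exp (s⁻¹ * Complex.I)) : ℂ × ℂ)).restrictScalars ℝ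

theorem jostGenerator_apply (c s : ℝ) (v : ℂ × ℂ) :
    jostGenerator c s v =
      (Complex.exp (s⁻¹ * Complex.I) * v.1 + Complex.exp (-(s⁻¹ * Complex.I)) * v.2) •
        (-(Complex.I * c / 2) * Complex.exp (-(s⁻¹ * Complex.I)),
          Complex.I * c / 2 * Complex.exp (s⁻¹ * Complex.I)) := rfl

theorem norm_exp_neg_ofReal_mul_I (x : ℝ) : ‖Complex.exp (-(x * Complex.I))‖ = 1 := by
  simpa using Complex.norm_exp_ofReal_mul_I (-x)

theorem norm_jostGenerator_le (c s : ℝ) : ‖jostGenerator c s‖ ≤ |c| := by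
  refine ContinuousLinearMap.opNorm_le_bound _ (abs_nonneg c) fun v => ?_
  have h₁ := Complex.norm_exp_ofReal_mul_I s⁻¹
  have h₂ := norm_exp_neg_ofReal_mul_I s⁻¹
  have hsum : ‖Complex.exp (s⁻¹ * Complex.I) * v.1 + Complex.exp (-(s⁻¹ * Complex.I)) * v.2‖ ≤
      2 * ‖v‖ := by
    refine (norm_add_le _ _).trans ?_
    rw [norm_mul, norm_mul, h₁, h₂]
    linarith [norm_fst_le v, norm_snd_le v]
  have hvec : ‖((-(Complex.I * c / 2) * Complex.exp (-(s⁻¹ * Complex.I)),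
      Complex.I * c / 2 * Complex.exp (s⁻¹ * Complex.I)) : ℂ × ℂ)‖ ≤ |c| / 2 := by
    refine norm_prod_le_iff.2 ⟨?_, ?_⟩ <;> simp only [norm_mul, h₁, h₂] <;> simp
  rw [jostGenerator_apply, norm_smul]
  calc _ ≤ 2 * ‖v‖ * (|c| / 2) := by gcongr
    _ = |c| * ‖v‖ := by ring

theorem continuousOn_jostGenerator (c : ℝ) : ContinuousOn (jostGenerator c) (Set.Ioi 0) := by
  refine continuousOn_clm_apply.2 fun v => ?_
  have hinv : ContinuousOn (fun s : ℝ => ((s⁻¹ : ℝ) : ℂ)) (Set.Ioi 0) :=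
    Complex.continuous_ofReal.comp_continuousOn
      (continuousOn_inv₀.mono fun s hs => ne_of_gt hs)
  simp only [jostGenerator_apply]
  fun_prop

theorem hasDerivAt_comp_inv {V : Type*} [NormedAddCommGroup V] [NormedSpace ℝ V] {v v' : ℝ → V}
    (hv : ∀ s, 0 < s → HasDerivAt v (v' s) s) {x : ℝ} (hx : 0 < x) :
    HasDerivAt (fun x => v x⁻¹) (-(x ^ 2)⁻¹ • v' x⁻¹) x :=
  (hv x⁻¹ (inv_pos.2 hx)).scomp x (hasDerivAt_inv hx.ne')

theorem hasDerivAt_of_jostGenerator {c : ℝ} {v : ℝ → ℂ × ℂ}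
    (hv : ∀ s, 0 < s → HasDerivAt v (jostGenerator c s (v s)) s) {x : ℝ} (hx : 0 < x) :
    let e (x : ℝ) := Complex.exp (x * Complex.I)
    let e' (x : ℝ) := Complex.exp (-(x * Complex.I))
    let f (x : ℝ) := (v x⁻¹).1 * e x + (v x⁻¹).2 * e' x
    let f' (x : ℝ) := Complex.I * ((v x⁻¹).1 * e x - (v x⁻¹).2 * e' x)
    HasDerivAt f (f' x) x ∧ HasDerivAt f' (-((1 + c / x ^ 2) * f x)) x := by
  intro e e' f f'
  have hv' := hasDerivAt_comp_inv hv hx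
  have he : HasDerivAt e (e x * Complex.I) x := by
    simpa using ((hasDerivAt_id x).ofReal_comp.mul_const Complex.I).cexp
  have he' : HasDerivAt e' (e' x * -Complex.I) x := by
    simpa using ((hasDerivAt_id x).ofReal_comp.mul_const Complex.I).neg.cexp
  have hee' : e x * e' x = 1 := by rw [← Complex.exp_add, add_neg_cancel, Complex.exp_zero]
  have ha := ((ContinuousLinearMap.fst ℝ ℂ ℂ).hasFDerivAt.comp_hasDerivAt x hv').mul he
  have hb := ((ContinuousLinearMap.snd ℝ ℂ ℂ).hasFDerivAt.comp_hasDerivAt x hv').mul he'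
  simp only [jostGenerator_apply, inv_inv, ContinuousLinearMap.coe_fst',
    ContinuousLinearMap.coe_snd', Function.comp_apply, Prod.smul_fst, Prod.smul_snd, smul_eq_mul,
    Complex.real_smul] at ha hb
  push_cast at ha hb
  refine ⟨(ha.add hb).congr_deriv ?_, ((ha.sub hb).const_mul Complex.I).congr_deriv ?_⟩
  · simp only [f']
    ring
  · simp only [f]
    linear_combination (Complex.I ^ 2 * c * ((x : ℂ) ^ 2)⁻¹ * f x) * hee' +
      (c * ((x : ℂ) ^ 2)⁻¹ + 1) * f x * Complex.I_sq

theorem exists_isJostSolution (c : ℝ) : ∃ f f', IsJostSolution c f f' := by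
  obtain ⟨v, hvc, hv, hbound⟩ := exists_hasDerivAt_clm_apply (continuousOn_jostGenerator c)
    (fun s _ => norm_jostGenerator_le c s) (1, 0)
  refine ⟨_, _, ?_, ?_, fun x hx => (hasDerivAt_of_jostGenerator hv hx).1,
    fun x hx => (hasDerivAt_of_jostGenerator hv hx).2, fun ε hε => ?_⟩
  · fun_prop
  · fun_prop
  obtain ⟨C, hC⟩ := hbound ε⁻¹
  refine ⟨2 * C, fun x hx => ?_⟩
  have hx0 : 0 < x := hε.trans_le hx
  have hv := hC x⁻¹ ⟨(inv_pos.2 hx0).le, inv_anti₀ hε hx⟩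
  have ha : ‖(v x⁻¹).1 - 1‖ ≤ C * x⁻¹ := (norm_fst_le _).trans hv
  have hb : ‖(v x⁻¹).2‖ ≤ C * x⁻¹ := by simpa using (norm_snd_le _).trans hv
  have he := Complex.norm_exp_ofReal_mul_I x
  have he' := norm_exp_neg_ofReal_mul_I x
  have hC2 : 2 * C / x = C * x⁻¹ + C * x⁻¹ := by ring
  rw [hC2]
  constructor
  · calc _ = ‖((v x⁻¹).1 - 1) * Complex.exp (x * Complex.I) +
          (v x⁻¹).2 * Complex.exp (-(x * Complex.I))‖ := by ring_nf
      _ ≤ _ := norm_add_le_of_le (by rwa [norm_mul, he, mul_one])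
          (by rwa [norm_mul, he', mul_one])
  · calc _ = ‖Complex.I * (((v x⁻¹).1 - 1) * Complex.exp (x * Complex.I) -
          (v x⁻¹).2 * Complex.exp (-(x * Complex.I)))‖ := by ring_nf
      _ ≤ _ := by
        rw [norm_mul, Complex.norm_I, one_mul]
        exact norm_sub_le_of_le (by rwa [norm_mul, he, mul_one]) (by rwa [norm_mul, he', mul_one])

namespace IsJostSolution

open ComplexConjugate

variable {c : ℝ} {f f' : ℝ → ℂ}

theorem tendsto_exp_neg_mul (hf : IsJostSolution c f f') :
    Tendsto (fun x : ℝ => Complex.exp (-(x * Complex.I)) * f x) atTop (𝓝 1) ∧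
      Tendsto (fun x : ℝ => Complex.exp (-(x * Complex.I)) * f' x) atTop (𝓝 Complex.I) := by
  obtain ⟨C, hC⟩ := hf.exists_bound 1 one_pos
  have hlim : Tendsto (fun x : ℝ => C / x) atTop (𝓝 0) := tendsto_id.const_div_atTop C
  constructor <;> refine tendsto_iff_norm_sub_tendsto_zero.2 (squeeze_zero' ?_ ?_ hlim) <;>
    filter_upwards [eventually_ge_atTop 1] with x hx
  · positivity
  · refine Eq.trans_le ?_ (hC x hx).1
    rw [← one_mul ‖f x - _‖, ← norm_exp_neg_ofReal_mul_I x, ← norm_mul, mul_sub, ← Complex.exp_add,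
      neg_add_cancel, Complex.exp_zero]
  · positivity
  · refine Eq.trans_le ?_ (hC x hx).2
    rw [← one_mul ‖f' x - _‖, ← norm_exp_neg_ofReal_mul_I x, ← norm_mul, mul_sub, mul_left_comm,
      ← Complex.exp_add, neg_add_cancel, Complex.exp_zero, mul_one]

theorem exists_norm_le (hf : IsJostSolution c f f') {ε : ℝ} (hε : 0 < ε) :
    ∃ C, ∀ x, ε ≤ x → ‖f x‖ ≤ C ∧ ‖f' x‖ ≤ C := by
  obtain ⟨C, hC⟩ := hf.exists_bound ε hε
  refine ⟨1 + |C| / ε, fun x hx => ?_⟩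
  have hCx : C / x ≤ |C| / ε := by gcongr; exact le_abs_self C
  have he := Complex.norm_exp_ofReal_mul_I x
  have hIe : ‖Complex.I * Complex.exp (x * Complex.I)‖ = 1 := by
    rw [norm_mul, he, Complex.norm_I, one_mul]
  exact ⟨(norm_le_norm_add_norm_sub' _ _).trans (add_le_add he.le ((hC x hx).1.trans hCx)),
    (norm_le_norm_add_norm_sub' _ _).trans (add_le_add hIe.le ((hC x hx).2.trans hCx))⟩

theorem wronskian_eq (hf : IsJostSolution c f f') {x : ℝ} (hx : 0 < x) :
    f x * conj (f' x) - f' x * conj (f x) = -2 * Complex.I := by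
  let w (x : ℝ) := f x * conj (f' x) - f' x * conj (f x)
  have hderiv : ∀ x, 0 < x → HasDerivAt w 0 x := fun x hx => by
    have h := hf.hasDerivAt x hx
    have h' := hf.hasDerivAt_deriv x hx
    refine ((h.mul h'.star).sub (h'.mul h.star)).congr_deriv ?_
    simp only [star_neg, star_mul', star_add, star_one, star_div₀, star_pow, Complex.star_def,
      Complex.conj_ofReal]
    ring
  have hconst : ∀ y, 0 < y → w y = w x := fun y hy => by
    refine isOpen_Ioi.is_const_of_deriv_eq_zero isPreconnected_Ioi
      (fun z hz => (hderiv z hz).differentiableAt.differentiableWithinAt)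
      (fun z hz => (hderiv z hz).deriv) hy hx
  have hlim : Tendsto w atTop (𝓝 (-2 * Complex.I)) := by
    obtain ⟨h, h'⟩ := hf.tendsto_exp_neg_mul
    convert (h.mul h'.star).sub (h'.mul h.star) using 2 with y
    · have he : conj (Complex.exp (-(y * Complex.I))) * Complex.exp (-(y * Complex.I)) = 1 := by
        rw [Complex.conj_mul', norm_exp_neg_ofReal_mul_I]
        norm_num
      simp only [star_mul', Complex.star_def, w]
      linear_combination -(f y * conj (f' y) - f' y * conj (f y)) * he
    · simp only [star_one, Complex.star_def, Complex.conj_I]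
      ring
  refine tendsto_nhds_unique (tendsto_const_nhds.congr' ?_) hlim
  filter_upwards [eventually_gt_atTop 0] with y hy using (hconst y hy).symm

end IsJostSolution

end Jost

section Weight

variable {E : Type*} [NormedAddCommGroup E]

/-- The weight `(1 + |ξ| ^ 2) ^ (s / 2)` of the Sobolev space `H ^ s`. -/
def weight (s : ℝ) (ξ : E) : ℝ := (1 + ‖ξ‖ ^ 2) ^ (s / 2)

theorem weight_pos (s : ℝ) (ξ : E) : 0 < weight s ξ := Real.rpow_pos_of_pos (by positivity) _

theorem weight_zero (ξ : E) : weight 0 ξ = 1 := by rw [weight, zero_div, Real.rpow_zero]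

theorem weight_two (ξ : E) : weight 2 ξ = 1 + ‖ξ‖ ^ 2 := by
  rw [weight, div_self two_ne_zero, Real.rpow_one]

theorem weight_mul_weight (s r : ℝ) (ξ : E) : weight s ξ * weight r ξ = weight (s + r) ξ := by
  rw [weight, weight, weight, ← Real.rpow_add (by positivity), add_div]

theorem weight_neg_mul_weight_mul (s : ℝ) (ξ : E) (z : ℂ) :
    (weight (-s) ξ : ℂ) * (weight s ξ * z) = z := by
  rw [← mul_assoc, ← Complex.ofReal_mul, weight_mul_weight, neg_add_cancel, weight_zero,
    Complex.ofReal_one, one_mul]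

theorem one_le_weight {s : ℝ} (hs : 0 ≤ s) (ξ : E) : 1 ≤ weight s ξ :=
  Real.one_le_rpow (le_add_of_nonneg_right (sq_nonneg _)) (by positivity)

theorem weight_le_weight {s r : ℝ} (h : s ≤ r) (ξ : E) : weight s ξ ≤ weight r ξ :=
  Real.rpow_le_rpow_of_exponent_le (le_add_of_nonneg_right (sq_nonneg _)) (by gcongr)

theorem norm_le_weight_one (ξ : E) : ‖ξ‖ ≤ weight 1 ξ := by
  rw [weight, ← Real.sqrt_eq_rpow]
  exact Real.le_sqrt_of_sq_le (le_add_of_nonneg_left zero_le_one)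

theorem weight_one_le (ξ : E) : weight 1 ξ ≤ 1 + ‖ξ‖ := by
  rw [weight, ← Real.sqrt_eq_rpow]
  exact Real.sqrt_le_iff.2 ⟨by positivity, by nlinarith [norm_nonneg ξ]⟩

theorem continuous_weight (s : ℝ) : Continuous (weight s : E → ℝ) :=
  (by fun_prop : Continuous fun ξ : E => 1 + ‖ξ‖ ^ 2).rpow_const fun _ => Or.inl (by positivity)

theorem hasTemperateGrowth_weight [InnerProductSpace ℝ E] (s : ℝ) :
    (fun ξ : E => (weight s ξ : ℂ)).HasTemperateGrowth := by
  unfold weight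
  fun_prop

end Weight

section Density

open Distribution

variable {E : Type*} [NormedAddCommGroup E] [NormedSpace ℝ E] [MeasureSpace E]

/-- The tempered distribution `T` is given by integration against the function `F`. -/
structure HasDensity (T : 𝓢'(E, ℂ)) (F : E → ℂ) : Prop where
  integrable_mul (φ : 𝓢(E, ℂ)) : Integrable fun ξ => φ ξ * F ξ
  apply_eq_integral (φ : 𝓢(E, ℂ)) : T φ = ∫ ξ, φ ξ * F ξ

namespace HasDensity

variable {T S : 𝓢'(E, ℂ)} {F G : E → ℂ}

theorem ext (hT : HasDensity T F) (hS : HasDensity S F) : T = S := by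
  ext φ
  rw [hT.apply_eq_integral, hS.apply_eq_integral]

theorem congr (hT : HasDensity T F) (h : F =ᵐ[volume] G) : HasDensity T G where
  integrable_mul φ := (hT.integrable_mul φ).congr (h.mono fun ξ hξ => congrArg (φ ξ * ·) hξ)
  apply_eq_integral φ := by
    rw [hT.apply_eq_integral]
    exact integral_congr_ae (h.mono fun ξ hξ => congrArg (φ ξ * ·) hξ)

theorem add (hT : HasDensity T F) (hS : HasDensity S G) : HasDensity (T + S) (F + G) where
  integrable_mul φ := by
    simp only [Pi.add_apply, mul_add]
    exact (hT.integrable_mul φ).add (hS.integrable_mul φ)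
  apply_eq_integral φ := by
    simp only [Pi.add_apply, mul_add]
    rw [integral_add (hT.integrable_mul φ) (hS.integrable_mul φ), ← hT.apply_eq_integral,
      ← hS.apply_eq_integral, add_apply]

theorem smul (hT : HasDensity T F) (c : ℂ) : HasDensity (c • T) (c • F) where
  integrable_mul φ := by
    simpa only [Pi.smul_apply, smul_eq_mul, mul_left_comm] using (hT.integrable_mul φ).const_mul c
  apply_eq_integral φ := by
    simp only [Pi.smul_apply, smul_eq_mul, mul_left_comm]
    rw [integral_const_mul, ← hT.apply_eq_integral, smul_apply, smul_eq_mul]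

theorem sub (hT : HasDensity T F) (hS : HasDensity S G) : HasDensity (T - S) (F - G) := by
  rw [sub_eq_add_neg, sub_eq_add_neg, ← neg_one_smul ℂ S, ← neg_one_smul ℂ G]
  exact hT.add (hS.smul (-1))

theorem smulLeftCLM (hT : HasDensity T F) {g : E → ℂ} (hg : g.HasTemperateGrowth) :
    HasDensity (TemperedDistribution.smulLeftCLM ℂ g T) fun ξ => g ξ * F ξ := by
  have e (φ : 𝓢(E, ℂ)) (ξ : E) : SchwartzMap.smulLeftCLM ℂ g φ ξ * F ξ = φ ξ * (g ξ * F ξ) := by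
    rw [SchwartzMap.smulLeftCLM_apply_apply hg, smul_eq_mul, mul_assoc, mul_left_comm]
  refine ⟨fun φ => ?_, fun φ => ?_⟩
  · simpa only [e] using hT.integrable_mul (SchwartzMap.smulLeftCLM ℂ g φ)
  · rw [TemperedDistribution.smulLeftCLM_apply_apply, hT.apply_eq_integral]
    simp only [e]

section Support

variable [FiniteDimensional ℝ E] [HasContDiffBump E] [BorelSpace E]

theorem locallyIntegrable (hT : HasDensity T F) : LocallyIntegrable F := fun x => by
  let ψ : ContDiffBump x := ⟨1, 2, one_pos, one_lt_two⟩
  let φ : 𝓢(E, ℂ) := (ψ.hasCompactSupport.comp_left (g := Complex.ofRealCLM)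
    (map_zero _)).toSchwartzMap (Complex.ofRealCLM.contDiff.comp ψ.contDiff)
  refine ⟨Metric.closedBall x 1, Metric.closedBall_mem_nhds x one_pos, ?_⟩
  refine (hT.integrable_mul φ).integrableOn.congr_fun (fun ξ hξ => ?_)
    Metric.isClosed_closedBall.measurableSet
  have h1 : φ ξ = 1 := by
    change ((ψ ξ : ℝ) : ℂ) = 1
    rw [ψ.one_of_mem_closedBall hξ, Complex.ofReal_one]
  simp only [h1, one_mul]

theorem ae_eq_zero_of_isVanishingOn (hT : HasDensity T F) {U : Set E} (hU : IsOpen U)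
    (h : IsVanishingOn T U) : ∀ᵐ ξ, ξ ∈ U → F ξ = 0 := by
  refine hU.ae_eq_zero_of_integral_contDiff_smul_eq_zero
    (hT.locallyIntegrable.locallyIntegrableOn U) fun g hg hgc hgU => ?_
  let φ : 𝓢(E, ℂ) := (hgc.comp_left (g := Complex.ofRealCLM) (map_zero _)).toSchwartzMap
    (Complex.ofRealCLM.contDiff.comp hg)
  have hφ : T φ = 0 := h φ
    ((closure_mono (Function.support_comp_subset (map_zero Complex.ofRealCLM) g)).trans hgU)
  rwa [hT.apply_eq_integral] at hφ

theorem ae_eq (hF : HasDensity T F) (hG : HasDensity T G) : F =ᵐ[volume] G := by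
  have h0 : IsVanishingOn (T - T) Set.univ := fun φ _ => by rw [sub_self]; rfl
  filter_upwards [(hF.sub hG).ae_eq_zero_of_isVanishingOn isOpen_univ h0] with ξ hξ
  exact sub_eq_zero.1 (hξ trivial)

theorem ae_mem_dsupport (hT : HasDensity T F) : ∀ᵐ ξ, F ξ ≠ 0 → ξ ∈ dsupport T := by
  rw [ae_iff]
  refine measure_null_of_locally_null _ fun ξ hξ => ?_
  simp only [Classical.not_imp, Set.mem_ofPred_eq, notMem_dsupport_iff] at hξ
  obtain ⟨-, s, hs, hso, hξs⟩ := hξ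
  refine ⟨_, inter_mem_nhdsWithin _ (hso.mem_nhds hξs), ?_⟩
  refine measure_mono_null (fun η hη => ?_) (ae_iff.1 (hT.ae_eq_zero_of_isVanishingOn hso hs))
  simp only [Classical.not_imp, Set.mem_inter_iff, Set.mem_ofPred_eq] at hη ⊢
  exact ⟨hη.2, hη.1.1⟩

end Support

theorem hasDerivAt_apply {D : ℝ → 𝓢'(E, ℂ)} {y y' : ℝ → E → ℂ} {s : Set ℝ} {t : ℝ}
    (hs : s ∈ 𝓝 t) (hD : ∀ τ ∈ s, HasDensity (D τ) (y τ)) (hT : HasDensity T (y' t))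
    (hS : HasDensity S G) (hbound : ∀ᵐ ξ, ∀ τ ∈ s, ‖y' τ ξ‖ ≤ ‖G ξ‖)
    (hderiv : ∀ᵐ ξ, ∀ τ ∈ s, HasDerivAt (fun τ => y τ ξ) (y' τ ξ) τ) (φ : 𝓢(E, ℂ)) :
    HasDerivAt (fun τ => D τ φ) (T φ) t := by
  rw [hT.apply_eq_integral]
  refine (hasDerivAt_integral_of_dominated_loc_of_deriv_le (F := fun τ ξ => φ ξ * y τ ξ)
    (F' := fun τ ξ => φ ξ * y' τ ξ) hs ?_ ((hD t (mem_of_mem_nhds hs)).integrable_mul φ)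
    (hT.integrable_mul φ).1 ?_ (hS.integrable_mul φ).norm ?_).2.congr_of_eventuallyEq ?_
  · filter_upwards [hs] with τ hτ using ((hD τ hτ).integrable_mul φ).1
  · filter_upwards [hbound] with ξ hξ τ hτ
    rw [norm_mul, norm_mul]
    exact mul_le_mul_of_nonneg_left (hξ τ hτ) (norm_nonneg _)
  · filter_upwards [hderiv] with ξ hξ τ hτ using (hξ τ hτ).const_mul _
  · filter_upwards [hs] with τ hτ using (hD τ hτ).apply_eq_integral φ

end HasDensity

theorem hasDensity_toTemperedDistribution [BorelSpace E]
    [(volume : Measure E).HasTemperateGrowth] (f : Lp ℂ 2 (volume : Measure E)) :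
    HasDensity (Lp.toTemperedDistribution f) f where
  integrable_mul φ := (φ.memLp 2).integrable_mul (Lp.memLp f)
  apply_eq_integral φ := Lp.toTemperedDistribution_apply f φ

end Density

section Sobolev

variable {E : Type*} [NormedAddCommGroup E] [InnerProductSpace ℝ E] [FiniteDimensional ℝ E]
  [MeasurableSpace E] [BorelSpace E]

theorem exists_hasDensity {s : ℝ} {F : E → ℂ} (hF : MemLp (fun ξ => weight s ξ * F ξ) 2) :
    ∃ T : 𝓢'(E, ℂ), HasDensity T F := by
  refine ⟨_, ((hasDensity_toTemperedDistribution (hF.toLp _)).smulLeftCLM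
    (hasTemperateGrowth_weight (-s))).congr ?_⟩
  filter_upwards [hF.coeFn_toLp] with ξ hξ
  rw [hξ, weight_neg_mul_weight_mul]

theorem exists_fourier_hasDensity {s : ℝ} {f : 𝓢'(E, ℂ)}
    (hf : TemperedDistribution.MemSobolev s 2 f) :
    ∃ F : E → ℂ, MemLp (fun ξ => weight s ξ * F ξ) 2 ∧ HasDensity (𝓕 f) F := by
  obtain ⟨g, hg⟩ := TemperedDistribution.memSobolev_iff_exists_smulLeftCLM_fourier.1 hf
  refine ⟨fun ξ => weight (-s) ξ * g ξ, ?_, ?_⟩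
  · refine (Lp.memLp g).ae_eq (ae_of_all _ fun ξ => ?_)
    simpa only [neg_neg] using (weight_neg_mul_weight_mul (-s) ξ (g ξ)).symm
  · convert (hasDensity_toTemperedDistribution g).smulLeftCLM (hasTemperateGrowth_weight (-s))
    have h1 : ((fun ξ : E => (weight s ξ : ℂ)) * fun ξ => (weight (-s) ξ : ℂ)) = fun _ => 1 := by
      ext ξ
      rw [Pi.mul_apply, ← Complex.ofReal_mul, weight_mul_weight, add_neg_cancel, weight_zero,
        Complex.ofReal_one]
    rw [← hg]
    change _ = TemperedDistribution.smulLeftCLM ℂ _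
      (TemperedDistribution.smulLeftCLM ℂ (fun ξ => (weight s ξ : ℂ)) (𝓕 f))
    rw [TemperedDistribution.smulLeftCLM_smulLeftCLM_apply (hasTemperateGrowth_weight s)
      (hasTemperateGrowth_weight (-s)), h1, TemperedDistribution.smulLeftCLM_const, one_smul]

variable {n : ℕ} {f : 𝓢'(Space n, ℂ)} {F : Space n → ℂ}

theorem l2Norm_toTemperedDistribution (g : Lp ℂ 2 (volume : Measure (Space n))) :
    l2Norm (Lp.toTemperedDistribution g) = ‖g‖ₑ := by
  refine le_antisymm (iInf₂_le_of_le g rfl le_rfl) (le_iInf₂ fun g' h => ?_)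
  have hinj := LinearMap.ker_eq_bot.1 (Lp.ker_toTemperedDistributionCLM_eq_bot (E := Space n)
    (F := ℂ) (μ := volume) (p := 2))
  rw [hinj h]

theorem l2Norm_eq_eLpNorm (hf : HasDensity (𝓕 f) F) (hF : MemLp F 2) : l2Norm f = eLpNorm F 2 := by
  have hfF : 𝓕 f = Lp.toTemperedDistribution (hF.toLp F) :=
    hf.ext ((hasDensity_toTemperedDistribution _).congr hF.coeFn_toLp)
  have h : ‖(𝓕⁻ (hF.toLp F) : Lp ℂ 2 (volume : Measure (Space n)))‖ = ‖hF.toLp F‖ := by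
    rw [← Lp.norm_fourier_eq, FourierTransform.fourier_fourierInv_eq]
  rw [← FourierTransform.fourierInv_fourier_eq (F := 𝓢'(Space n, ℂ)) f, hfF,
    Lp.fourierInv_toTemperedDistribution_eq, l2Norm_toTemperedDistribution, ← ofReal_norm, h,
    ofReal_norm, Lp.enorm_toLp]

theorem sobolevNorm_eq_eLpNorm {s : ℝ} (hf : HasDensity (𝓕 f) F)
    (hF : MemLp (fun ξ => weight s ξ * F ξ) 2) :
    sobolevNorm s f = eLpNorm (fun ξ => weight s ξ * F ξ) 2 := by
  refine l2Norm_eq_eLpNorm ?_ hF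
  rw [TemperedDistribution.besselPotential, TemperedDistribution.fourierMultiplierCLM_apply,
    FourierTransform.fourier_fourierInv_eq]
  exact hf.smulLeftCLM (hasTemperateGrowth_weight s)

end Sobolev

section FourierEvolution

variable {E : Type*} [NormedAddCommGroup E]

/-- The angular frequency of the frequency variable of the Fourier transform with kernel
`exp (-2 π i x · ξ)`. -/
def freq (ξ : E) : ℝ := 2 * Real.pi * ‖ξ‖

theorem freq_mono {δ : ℝ} {ξ : E} (h : δ ≤ ‖ξ‖) : 2 * Real.pi * δ ≤ freq ξ :=
  mul_le_mul_of_nonneg_left h (by positivity)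

theorem continuous_freq : Continuous (freq : E → ℝ) := continuous_norm.const_mul _

theorem weight_freq_le {s : ℝ} (hs : 0 ≤ s) (ξ : E) :
    weight s (freq ξ) ≤ (2 * Real.pi) ^ s * weight s ξ := by
  have hpi : 1 ≤ 2 * Real.pi := by linarith [Real.two_le_pi]
  have hpow : (2 * Real.pi) ^ s = ((2 * Real.pi) ^ 2) ^ (s / 2) := by
    rw [← Real.rpow_natCast, ← Real.rpow_mul (by positivity), Nat.cast_ofNat,
      mul_div_cancel₀ s two_ne_zero]
  rw [weight, weight, hpow, ← Real.mul_rpow (by positivity) (by positivity), freq, norm_mul,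
    norm_norm, Real.norm_of_nonneg (by positivity), mul_pow, mul_add, mul_one]
  gcongr
  exact one_le_pow₀ hpi

theorem hasTemperateGrowth_freq_sq [InnerProductSpace ℝ E] :
    (fun ξ : E => ((freq ξ ^ 2 : ℝ) : ℂ)).HasTemperateGrowth := by
  simp_rw [freq, mul_pow]
  fun_prop

variable [InnerProductSpace ℝ E] [FiniteDimensional ℝ E] [MeasurableSpace E] [BorelSpace E]

theorem fourier_laplacian (f : 𝓢'(E, ℂ)) :
    𝓕 (Δ f) = -TemperedDistribution.smulLeftCLM ℂ (fun ξ => ((freq ξ ^ 2 : ℝ) : ℂ)) (𝓕 f) := by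
  have hg : (fun ξ : E => ((‖ξ‖ ^ 2 : ℝ) : ℂ)).HasTemperateGrowth := by fun_prop
  have hfreq : (fun ξ : E => ((freq ξ ^ 2 : ℝ) : ℂ)) =
      (((2 * Real.pi) ^ 2 : ℝ) : ℂ) • fun ξ => ((‖ξ‖ ^ 2 : ℝ) : ℂ) := by
    ext ξ
    rw [freq, mul_pow, Complex.ofReal_mul, Pi.smul_apply, smul_eq_mul]
  ext φ
  rw [hfreq, TemperedDistribution.laplacian_eq_fourierMultiplierCLM,
    TemperedDistribution.smulLeftCLM_smul hg]
  simp [TemperedDistribution.fourierMultiplierCLM_apply]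

theorem fourierInv_smulLeftCLM_freq_sq (T : 𝓢'(E, ℂ)) :
    𝓕⁻ (TemperedDistribution.smulLeftCLM ℂ (fun ξ => ((freq ξ ^ 2 : ℝ) : ℂ)) T) =
      -Δ (𝓕⁻ T : 𝓢'(E, ℂ)) := by
  have h := fourier_laplacian (𝓕⁻ T : 𝓢'(E, ℂ))
  rw [FourierTransform.fourier_fourierInv_eq] at h
  rw [← neg_eq_iff_eq_neg.2 h, FourierTransform.fourierInv_neg,
    FourierTransform.fourierInv_fourier_eq]

variable {n : ℕ} {b : ℝ → ℝ} {I : Set ℝ}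

theorem exists_isDampedOscillation_fourier {u : ℝ → 𝓢'(Space n, ℂ)} {u₀ u₁ : 𝓢'(Space n, ℂ)}
    (hu : SolvesCauchyProblem b I u u₀ u₁) :
    ∃ ut : ℝ → 𝓢'(Space n, ℂ), u 1 = u₀ ∧ ut 1 = u₁ ∧
      IsDampedOscillation (fun ξ => ((freq ξ ^ 2 : ℝ) : ℂ)) b I
        (fun t => 𝓕 (u t)) fun t => 𝓕 (ut t) := by
  obtain ⟨ut, utt, hut, hutt, -, heq, hu₀, hu₁⟩ := hu
  refine ⟨ut, hu₀, hu₁, fun φ t ht => hut (𝓕 φ) t ht, fun φ t ht =>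
    (hutt (𝓕 φ) t ht).congr_deriv ?_⟩
  have hlap := DFunLike.congr_fun (fourier_laplacian (u t)) φ
  have heq := DFunLike.congr_fun (heq t ht) (𝓕 φ)
  simp only [add_apply, sub_apply, smul_apply, smul_eq_mul, neg_apply, zero_apply,
    TemperedDistribution.fourier_apply, TemperedDistribution.smulLeftCLM_apply_apply] at *
  linear_combination heq + hlap

theorem IsDampedOscillation.solvesCauchyProblem_fourierInv {D D₁ : ℝ → 𝓢'(Space n, ℂ)}
    (hD : IsDampedOscillation (fun ξ => ((freq ξ ^ 2 : ℝ) : ℂ)) b I D D₁)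
    (hb : ContinuousOn b I) :
    SolvesCauchyProblem b I (fun t => 𝓕⁻ (D t)) (𝓕⁻ (D 1)) (𝓕⁻ (D₁ 1)) := by
  let g : Space n → ℂ := fun ξ => ((freq ξ ^ 2 : ℝ) : ℂ)
  refine ⟨fun t => 𝓕⁻ (D₁ t),
    fun t => 𝓕⁻ (-(TemperedDistribution.smulLeftCLM ℂ g (D t) + (b t : ℂ) • D₁ t)),
    fun φ => hD.hasDerivWithinAt (𝓕⁻ φ), fun φ => hD.hasDerivWithinAt_deriv (𝓕⁻ φ),
    fun φ => ?_, fun t _ => ?_, rfl, rfl⟩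
  · have hcont : ContinuousOn (fun t => D t (SchwartzMap.smulLeftCLM ℂ g (𝓕⁻ φ))) I :=
      fun t ht => (hD.hasDerivWithinAt (SchwartzMap.smulLeftCLM ℂ g (𝓕⁻ φ)) t
        ht).continuousWithinAt
    have hcont₁ : ContinuousOn (fun t => D₁ t (𝓕⁻ φ)) I := fun t ht =>
      (hD.hasDerivWithinAt_deriv (𝓕⁻ φ) t ht).continuousWithinAt
    exact (hcont.add ((Complex.continuous_ofReal.comp_continuousOn hb).mul hcont₁)).neg
  · beta_reduce
    rw [FourierTransform.fourierInv_neg, FourierTransform.fourierInv_add,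
      FourierTransform.fourierInv_smul, fourierInv_smulLeftCLM_freq_sq]
    abel

end FourierEvolution

section Modes

/-- A family of solutions `t ↦ θ t k` of `θ'' + b θ' + k ^ 2 θ = 0` on `I`, with derivatives `θ₁`,
indexed by the frequencies `k ≥ κ` and bounded like a plane wave `exp (i t k)`, locally uniformly
in time. -/
structure IsMode (b : ℝ → ℝ) (I : Set ℝ) (κ : ℝ) (θ θ₁ : ℝ → ℝ → ℂ) : Prop where
  measurable : ∀ t, Measurable (θ t)
  measurable_deriv : ∀ t, Measurable (θ₁ t)
  hasDerivAt : ∀ t ∈ I, ∀ k, κ ≤ k → HasDerivAt (fun τ => θ τ k) (θ₁ t k) t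
  hasDerivAt_deriv : ∀ t ∈ I, ∀ k, κ ≤ k →
    HasDerivAt (fun τ => θ₁ τ k) (-((k : ℂ) ^ 2 * θ t k + b t * θ₁ t k)) t
  exists_bound : ∀ t ∈ I, ∃ K, ∀ᶠ τ in 𝓝 t, ∀ k, κ ≤ k →
    ‖θ τ k‖ ≤ K ∧ ‖θ₁ τ k‖ ≤ K * weight 1 k

theorem IsMode.exists_norm_deriv_deriv_le {b : ℝ → ℝ} {I : Set ℝ} {κ t : ℝ} {θ θ₁ : ℝ → ℝ → ℂ}
    (hθ : IsMode b I κ θ θ₁) (ht : t ∈ I) (hb : ContinuousAt b t) :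
    ∃ K, ∀ᶠ τ in 𝓝 t, ∀ k, κ ≤ k →
      ‖-((k : ℂ) ^ 2 * θ τ k + b τ * θ₁ τ k)‖ ≤ K * weight 2 k := by
  obtain ⟨K, hK⟩ := hθ.exists_bound t ht
  refine ⟨K + (‖b t‖ + 1) * K, ?_⟩
  filter_upwards [hK, hb.norm.eventually_lt_const (lt_add_one _)] with τ hKτ hbτ k hk
  obtain ⟨hθK, hθ₁K⟩ := hKτ k hk
  have hK0 : 0 ≤ K := (norm_nonneg _).trans hθK
  have hk2 : k ^ 2 ≤ weight 2 k := by
    rw [weight_two, Real.norm_eq_abs, sq_abs]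
    exact le_add_of_nonneg_left zero_le_one
  calc ‖-((k : ℂ) ^ 2 * θ τ k + b τ * θ₁ τ k)‖
      ≤ k ^ 2 * ‖θ τ k‖ + ‖b τ‖ * ‖θ₁ τ k‖ := by
        rw [norm_neg]
        refine (norm_add_le _ _).trans_eq ?_
        rw [norm_mul, norm_mul, norm_pow, Complex.norm_real, Complex.norm_real, Real.norm_eq_abs k,
          sq_abs]
    _ ≤ weight 2 k * K + (‖b t‖ + 1) * (K * weight 2 k) := by
        gcongr
        · exact (weight_pos 2 k).le
        · exact hθ₁K.trans (mul_le_mul_of_nonneg_left (weight_le_weight one_le_two k) hK0)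
    _ = (K + (‖b t‖ + 1) * K) * weight 2 k := by ring

/-- The plane wave `exp (i t k)`, as a function of the time `t` and the frequency `k`. -/
def freeMode (t k : ℝ) : ℂ := Complex.exp ((t * k : ℝ) * Complex.I)

/-- The time derivative of `freeMode`. -/
def freeModeDeriv (t k : ℝ) : ℂ := k * Complex.I * freeMode t k

theorem norm_freeMode (t k : ℝ) : ‖freeMode t k‖ = 1 := Complex.norm_exp_ofReal_mul_I _

theorem norm_freeModeDeriv_le (t k : ℝ) : ‖freeModeDeriv t k‖ ≤ weight 1 k := by
  rw [freeModeDeriv, norm_mul, norm_freeMode, mul_one, norm_mul, Complex.norm_I, mul_one,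
    Complex.norm_real]
  exact norm_le_weight_one k

theorem isMode_freeMode (κ : ℝ) : IsMode (fun _ => 0) Set.univ κ freeMode freeModeDeriv where
  measurable t := by unfold freeMode; fun_prop
  measurable_deriv t := by unfold freeModeDeriv freeMode; fun_prop
  hasDerivAt t _ k _ := by
    refine ((((hasDerivAt_id t).mul_const k).ofReal_comp.mul_const Complex.I).cexp).congr_deriv ?_
    simp only [freeModeDeriv, freeMode, id, one_mul]
    ring
  hasDerivAt_deriv t _ k _ := by
    refine (((((hasDerivAt_id t).mul_const k).ofReal_comp.mul_const Complex.I).cexp).const_mul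
      (k * Complex.I)).congr_deriv ?_
    simp only [freeMode, id, one_mul, Complex.ofReal_zero, zero_mul, add_zero]
    linear_combination (k : ℂ) ^ 2 * Complex.exp ((t * k : ℝ) * Complex.I) * Complex.I_sq
  exists_bound t _ := ⟨1, Eventually.of_forall fun τ k _ =>
    ⟨(norm_freeMode τ k).le, (norm_freeModeDeriv_le τ k).trans_eq (one_mul _).symm⟩⟩

/-- The Liouville transformation `t ^ (-μ) f (t k)` of a function `f`. It turns the equation
`f'' + (1 + (μ - μ ^ 2) / x ^ 2) f = 0` into that of the weakly damped wave with frequency `k`. -/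
def dampedMode (μ : ℝ) (f : ℝ → ℂ) (t k : ℝ) : ℂ := (t ^ (-μ) : ℝ) * f (t * k)

/-- The time derivative of `dampedMode μ f`, where `f'` is the derivative of `f`. -/
def dampedModeDeriv (μ : ℝ) (f f' : ℝ → ℂ) (t k : ℝ) : ℂ :=
  (t ^ (-μ) : ℝ) * (k * f' (t * k) - (μ / t : ℝ) * f (t * k))

theorem hasDerivAt_dampedMode {μ t k : ℝ} {f : ℝ → ℂ} {f' : ℂ} (ht : 0 < t)
    (hf : HasDerivAt f f' (t * k)) :
    HasDerivAt (fun τ => dampedMode μ f τ k)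
      ((t ^ (-μ) : ℝ) * (k * f' - (μ / t : ℝ) * f (t * k))) t := by
  have hpow := (Real.hasDerivAt_rpow_const (x := t) (p := -μ) (Or.inl ht.ne')).ofReal_comp
  have hft := hf.scomp t (h := (· * k)) ((hasDerivAt_id t).mul_const k)
  refine (hpow.mul hft).congr_deriv ?_
  rw [Real.rpow_sub_one ht.ne']
  simp only [Function.comp, Complex.real_smul]
  push_cast
  ring

theorem hasDerivAt_dampedModeDeriv {μ t k : ℝ} {f f' : ℝ → ℂ} (ht : 0 < t) (hk : 0 < k)
    (hf : HasDerivAt f (f' (t * k)) (t * k))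
    (hf' : HasDerivAt f' (-((1 + ((μ - μ ^ 2 : ℝ) : ℂ) / (t * k : ℝ) ^ 2) * f (t * k))) (t * k)) :
    HasDerivAt (fun τ => dampedModeDeriv μ f f' τ k)
      (-((k : ℂ) ^ 2 * dampedMode μ f t k + (2 * μ / t : ℝ) * dampedModeDeriv μ f f' t k)) t := by
  have hpow := (Real.hasDerivAt_rpow_const (x := t) (p := -μ) (Or.inl ht.ne')).ofReal_comp
  have hinv := ((hasDerivAt_inv ht.ne').const_mul μ).ofReal_comp
  have hft := hf.scomp t (h := (· * k)) ((hasDerivAt_id t).mul_const k)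
  have hft' := hf'.scomp t (h := (· * k)) ((hasDerivAt_id t).mul_const k)
  refine (hpow.mul ((hft'.const_mul (k : ℂ)).sub (hinv.mul hft))).congr_deriv ?_
  have ht' : (t : ℂ) ≠ 0 := Complex.ofReal_ne_zero.2 ht.ne'
  have hk' : (k : ℂ) ≠ 0 := Complex.ofReal_ne_zero.2 hk.ne'
  rw [Real.rpow_sub_one ht.ne', dampedMode, dampedModeDeriv]
  simp only [Function.comp, Complex.real_smul, Pi.sub_apply, Pi.mul_apply]
  push_cast
  field_simp
  ring

namespace IsJostSolution

variable {μ κ : ℝ} {f f' : ℝ → ℂ}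

theorem exists_norm_dampedMode_le (hf : IsJostSolution (μ - μ ^ 2) f f') (hκ : 0 < κ) {t : ℝ}
    (ht : 0 < t) : ∃ K, ∀ᶠ τ in 𝓝 t, ∀ k, κ ≤ k →
      ‖dampedMode μ f τ k‖ ≤ K ∧ ‖dampedModeDeriv μ f f' τ k‖ ≤ K * weight 1 k := by
  obtain ⟨C, hC⟩ := hf.exists_norm_le (ε := t / 2 * κ) (by positivity)
  have hC0 : 0 ≤ C := (norm_nonneg _).trans (hC _ le_rfl).1
  refine ⟨(t ^ (-μ) + 1) * (C * (1 + (|μ| / t + 1))), ?_⟩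
  have hpow : ∀ᶠ τ in 𝓝 t, τ ^ (-μ) < t ^ (-μ) + 1 :=
    (Real.continuousAt_rpow_const t _ (Or.inl ht.ne')).eventually_lt_const (lt_add_one _)
  have hdiv : ∀ᶠ τ in 𝓝 t, |μ| / τ < |μ| / t + 1 :=
    (continuousAt_const.div continuousAt_id ht.ne').eventually_lt_const (lt_add_one _)
  filter_upwards [hpow, hdiv, lt_mem_nhds (half_lt_self ht)] with τ hpowτ hdivτ hτ k hk
  have hτ0 : 0 < τ := (half_pos ht).trans hτ
  have : 0 < k := hκ.trans_le hk
  obtain ⟨hfC, hfC'⟩ := hC (τ * k) (by gcongr)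
  have hpow_norm : ‖((τ ^ (-μ) : ℝ) : ℂ)‖ ≤ t ^ (-μ) + 1 := by
    rw [Complex.norm_real, Real.norm_of_nonneg (by positivity)]
    exact hpowτ.le
  have hdiv_norm : ‖((μ / τ : ℝ) : ℂ)‖ ≤ |μ| / t + 1 := by
    rw [Complex.norm_real, norm_div, Real.norm_of_nonneg hτ0.le]
    exact hdivτ.le
  have hk_norm : ‖(k : ℂ)‖ ≤ weight 1 k := (Complex.norm_real k).trans_le (norm_le_weight_one k)
  have hw : 1 ≤ weight 1 k := one_le_weight zero_le_one k
  rw [dampedMode, dampedModeDeriv, norm_mul, norm_mul, mul_assoc]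
  constructor
  · gcongr
    exact hfC.trans (le_mul_of_one_le_right hC0 (le_add_of_nonneg_right (by positivity)))
  · gcongr
    calc ‖k * f' (τ * k) - (μ / τ : ℝ) * f (τ * k)‖
        ≤ ‖(k : ℂ)‖ * ‖f' (τ * k)‖ + ‖((μ / τ : ℝ) : ℂ)‖ * ‖f (τ * k)‖ := by
          rw [← norm_mul, ← norm_mul]
          exact norm_sub_le _ _
      _ ≤ weight 1 k * C + (|μ| / t + 1) * C := by gcongr
      _ ≤ weight 1 k * C + (|μ| / t + 1) * C * weight 1 k := by
          exact add_le_add_right (le_mul_of_one_le_right (by positivity) hw) _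
      _ = C * (1 + (|μ| / t + 1)) * weight 1 k := by ring

theorem isMode_dampedMode (hf : IsJostSolution (μ - μ ^ 2) f f') (hκ : 0 < κ) :
    IsMode (fun t => 2 * μ / t) (Set.Ioi 0) κ (dampedMode μ f) (dampedModeDeriv μ f f') where
  measurable t := (hf.measurable.comp (measurable_const_mul t)).const_mul _
  measurable_deriv t := ((Complex.measurable_ofReal.mul (hf.measurable_deriv.comp
    (measurable_const_mul t))).sub ((hf.measurable.comp
      (measurable_const_mul t)).const_mul _)).const_mul _
  hasDerivAt _ ht _ hk := hasDerivAt_dampedMode ht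
    (hf.hasDerivAt _ (mul_pos ht (hκ.trans_le hk)))
  hasDerivAt_deriv _ ht _ hk := hasDerivAt_dampedModeDeriv ht (hκ.trans_le hk)
    (hf.hasDerivAt _ (mul_pos ht (hκ.trans_le hk)))
    (hf.hasDerivAt_deriv _ (mul_pos ht (hκ.trans_le hk)))
  exists_bound _ ht := hf.exists_norm_dampedMode_le hκ ht

theorem exists_norm_rpow_mul_dampedMode_sub_freeMode_le (hf : IsJostSolution (μ - μ ^ 2) f f')
    (hκ : 0 < κ) : ∃ C, ∀ t, 1 ≤ t → ∀ k, κ ≤ k →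
      ‖(t ^ μ : ℝ) * dampedMode μ f t k - freeMode t k‖ ≤ C * t⁻¹ := by
  obtain ⟨C, hC⟩ := hf.exists_bound κ hκ
  refine ⟨|C| / κ, fun t ht k hk => ?_⟩
  have ht0 : 0 < t := one_pos.trans_le ht
  have hκtk : κ ≤ t * k := hk.trans (le_mul_of_one_le_left (hκ.le.trans hk) ht)
  have hcancel : (t ^ μ : ℝ) * dampedMode μ f t k = f (t * k) := by
    rw [dampedMode, ← mul_assoc, ← Complex.ofReal_mul, ← Real.rpow_add ht0, add_neg_cancel,
      Real.rpow_zero, Complex.ofReal_one, one_mul]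
  rw [hcancel, freeMode]
  calc _ ≤ C / (t * k) := (hC _ hκtk).1
    _ ≤ |C| / (κ * t) := by
      rw [mul_comm t]
      gcongr
      exact le_abs_self C
    _ = |C| / κ * t⁻¹ := by rw [div_mul_eq_div_div, div_eq_mul_inv _ t]

end IsJostSolution

end Modes

section Superposition

/-- Amplitudes `A`, `B`, as functions of the frequency `k ≥ κ`, for which `superposition` is bounded
by `C` in terms of the initial position and of the initial velocity divided by `k`. -/
structure IsAmplitudePair (κ C : ℝ) (A B : ℝ → ℂ) : Prop where
  measurable_fst : Measurable A
  measurable_snd : Measurable B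
  norm_fst_le : ∀ k, κ ≤ k → ‖A k‖ ≤ C
  norm_snd_le : ∀ k, κ ≤ k → ‖B k‖ ≤ C / k

variable {E : Type*} [NormedAddCommGroup E]

/-- The superposition, with respect to the initial position `F` and the initial velocity `G`, of the
real waves with profile `θ` and amplitudes `A` and `B`. -/
def superposition (A B θ : ℝ → ℂ) (F G : E → ℂ) (ξ : E) : ℂ :=
  ((θ (freq ξ) * A (freq ξ)).re : ℂ) * F ξ + ((θ (freq ξ) * B (freq ξ)).re : ℂ) * G ξ

/-- The pointwise counterpart of the norm of `L² × H⁻¹`. -/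
def dataSize (F G : E → ℂ) (ξ : E) : ℝ := ‖F ξ‖ + ‖weight (-1) ξ * G ξ‖

theorem dataSize_nonneg (F G : E → ℂ) (ξ : E) : 0 ≤ dataSize F G ξ :=
  add_nonneg (norm_nonneg _) (norm_nonneg _)

section Algebra

variable (A B θ : ℝ → ℂ) (F G : E → ℂ)

theorem superposition_add_data (F' G' : E → ℂ) :
    superposition A B θ (F + F') (G + G') =
      superposition A B θ F G + superposition A B θ F' G' := by
  ext ξ
  simp only [superposition, Pi.add_apply]
  ring

theorem superposition_smul_data (c : ℂ) :
    superposition A B θ (c • F) (c • G) = c • superposition A B θ F G := by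
  ext ξ
  simp only [superposition, Pi.smul_apply, smul_eq_mul]
  ring

variable {A B θ F G} in
theorem superposition_congr_data [MeasureSpace E] {F' G' : E → ℂ} (hF : F =ᵐ[volume] F')
    (hG : G =ᵐ[volume] G') : superposition A B θ F G =ᵐ[volume] superposition A B θ F' G' := by
  filter_upwards [hF, hG] with ξ hFξ hGξ
  rw [superposition, superposition, hFξ, hGξ]

theorem superposition_sub_profile (θ' : ℝ → ℂ) :
    superposition A B (θ - θ') F G = superposition A B θ F G - superposition A B θ' F G := by
  ext ξ
  simp only [superposition, Pi.sub_apply, sub_mul, Complex.sub_re, Complex.ofReal_sub]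
  ring

theorem superposition_ofReal_mul_profile (c : ℝ) :
    superposition A B (fun k => c * θ k) F G = (c : ℂ) • superposition A B θ F G := by
  ext ξ
  simp only [superposition, Pi.smul_apply, smul_eq_mul, mul_assoc, Complex.re_ofReal_mul,
    Complex.ofReal_mul]
  ring

theorem superposition_oscillator_profile (θ₁ : ℝ → ℂ) (b : ℝ) :
    superposition A B (fun k => -((k : ℂ) ^ 2 * θ k + b * θ₁ k)) F G =
      (-1 : ℂ) • ((fun ξ => ((freq ξ ^ 2 : ℝ) : ℂ) * superposition A B θ F G ξ) +
        (b : ℂ) • superposition A B θ₁ F G) := by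
  ext ξ
  simp only [superposition, Pi.smul_apply, Pi.add_apply, smul_eq_mul, neg_mul, add_mul, mul_assoc,
    ← Complex.ofReal_pow, Complex.neg_re, Complex.add_re, Complex.re_ofReal_mul,
    Complex.ofReal_neg, Complex.ofReal_add, Complex.ofReal_mul]
  ring

end Algebra

theorem hasDerivAt_superposition {A B : ℝ → ℂ} {F G : E → ℂ} {θ : ℝ → ℝ → ℂ} {θ' : ℝ → ℂ} {t : ℝ}
    {ξ : E} (h : HasDerivAt (fun τ => θ τ (freq ξ)) (θ' (freq ξ)) t) :
    HasDerivAt (fun τ => superposition A B (θ τ) F G ξ) (superposition A B θ' F G ξ) t :=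
  ((Complex.reCLM.hasFDerivAt.comp_hasDerivAt t (h.mul_const _)).ofReal_comp.mul_const _).add
    ((Complex.reCLM.hasFDerivAt.comp_hasDerivAt t (h.mul_const _)).ofReal_comp.mul_const _)

variable {δ C K s : ℝ} {A B θ : ℝ → ℂ} {F G : E → ℂ}

theorem IsAmplitudePair.nonneg {κ : ℝ} (hA : IsAmplitudePair κ C A B) : 0 ≤ C :=
  (norm_nonneg _).trans (hA.norm_fst_le _ le_rfl)

theorem norm_div_freq_le (hδ : 0 < δ) {ξ : E} (hξ : δ ≤ ‖ξ‖) (z : ℂ) :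
    ‖z‖ / freq ξ ≤ (1 + δ⁻¹) * ‖weight (-1) ξ * z‖ := by
  have hξ0 : 0 < ‖ξ‖ := hδ.trans_le hξ
  have hweight : weight 1 ξ ≤ ‖ξ‖ * (1 + δ⁻¹) := by
    have hone : 1 ≤ δ⁻¹ * ‖ξ‖ := by rwa [inv_mul_eq_div, one_le_div hδ]
    linarith [weight_one_le ξ]
  have hfreq : ‖ξ‖ ≤ freq ξ := le_mul_of_one_le_left hξ0.le (by linarith [Real.two_le_pi])
  rw [div_le_iff₀ (hξ0.trans_le hfreq)]
  calc ‖z‖ = weight 1 ξ * ‖weight (-1) ξ * z‖ := by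
        rw [norm_mul, Complex.norm_real, Real.norm_of_nonneg (weight_pos _ ξ).le, ← mul_assoc,
          weight_mul_weight, add_neg_cancel, weight_zero, one_mul]
    _ ≤ ‖ξ‖ * (1 + δ⁻¹) * ‖weight (-1) ξ * z‖ := by gcongr
    _ ≤ freq ξ * (1 + δ⁻¹) * ‖weight (-1) ξ * z‖ := by gcongr
    _ = _ := by ring

theorem norm_superposition_le (hA : IsAmplitudePair (2 * Real.pi * δ) C A B) (hδ : 0 < δ) {ξ : E}
    (hξ : δ ≤ ‖ξ‖) :
    ‖superposition A B θ F G ξ‖ ≤ ‖θ (freq ξ)‖ * (C * (1 + δ⁻¹) * dataSize F G ξ) := by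
  have hC := hA.nonneg
  have hre (z w : ℂ) : ‖((z.re : ℝ) : ℂ) * w‖ ≤ ‖z‖ * ‖w‖ := by
    rw [norm_mul, Complex.norm_real]
    exact mul_le_mul_of_nonneg_right (Complex.abs_re_le_norm z) (norm_nonneg w)
  have hG := norm_div_freq_le hδ hξ (G ξ)
  have hF : ‖F ξ‖ ≤ (1 + δ⁻¹) * ‖F ξ‖ :=
    le_mul_of_one_le_left (norm_nonneg _) (le_add_of_nonneg_right (by positivity))
  calc ‖superposition A B θ F G ξ‖
      ≤ ‖θ (freq ξ) * A (freq ξ)‖ * ‖F ξ‖ + ‖θ (freq ξ) * B (freq ξ)‖ * ‖G ξ‖ :=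
        (norm_add_le _ _).trans (add_le_add (hre _ _) (hre _ _))
    _ ≤ ‖θ (freq ξ)‖ * C * ‖F ξ‖ + ‖θ (freq ξ)‖ * (C / freq ξ) * ‖G ξ‖ := by
        rw [norm_mul, norm_mul]
        gcongr
        exacts [hA.norm_fst_le _ (freq_mono hξ), hA.norm_snd_le _ (freq_mono hξ)]
    _ = ‖θ (freq ξ)‖ * (C * (‖F ξ‖ + ‖G ξ‖ / freq ξ)) := by ring
    _ ≤ ‖θ (freq ξ)‖ * (C * ((1 + δ⁻¹) * ‖F ξ‖ + (1 + δ⁻¹) * ‖weight (-1) ξ * G ξ‖)) := by gcongr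
    _ = _ := by rw [dataSize]; ring

variable [MeasureSpace E]

/-- `F` and `G` are the Fourier transforms of Cauchy data in `L² × H⁻¹` with frequencies at distance
at least `δ` from the origin. -/
structure IsFourierData (δ : ℝ) (F G : E → ℂ) : Prop where
  memLp_fst : MemLp F 2
  memLp_snd : MemLp (fun ξ => weight (-1) ξ * G ξ) 2
  ae_le_norm : ∀ᵐ ξ, F ξ ≠ 0 ∨ G ξ ≠ 0 → δ ≤ ‖ξ‖

namespace IsFourierData

theorem ae_superposition_eq_zero_or (hF : IsFourierData δ F G) :
    ∀ᵐ ξ, (dataSize F G ξ = 0 ∧ ∀ A B θ, superposition A B θ F G ξ = 0) ∨ δ ≤ ‖ξ‖ := by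
  filter_upwards [hF.ae_le_norm] with ξ hξ
  by_cases h : F ξ ≠ 0 ∨ G ξ ≠ 0
  · exact Or.inr (hξ h)
  · obtain ⟨hFξ, hGξ⟩ : F ξ = 0 ∧ G ξ = 0 := by simpa only [ne_eq, not_or, not_not] using h
    refine Or.inl ⟨?_, fun A B θ => ?_⟩
    · rw [dataSize, hFξ, hGξ, mul_zero, norm_zero, add_zero]
    · rw [superposition, hFξ, hGξ, mul_zero, mul_zero, add_zero]

theorem memLp_dataSize (hF : IsFourierData δ F G) : MemLp (dataSize F G) 2 :=
  hF.memLp_fst.norm.add hF.memLp_snd.norm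

theorem eLpNorm_dataSize_le (hF : IsFourierData δ F G) :
    eLpNorm (dataSize F G) 2 ≤ eLpNorm F 2 + eLpNorm (fun ξ => weight (-1) ξ * G ξ) 2 :=
  (eLpNorm_add_le hF.memLp_fst.norm.1 hF.memLp_snd.norm.1 one_le_two).trans_eq
    (congrArg₂ _ (eLpNorm_norm F) (eLpNorm_norm _))

theorem ae_norm_superposition_le (hF : IsFourierData δ F G) (hδ : 0 < δ)
    (hA : IsAmplitudePair (2 * Real.pi * δ) C A B) (hs : 0 ≤ s) :
    ∀ᵐ ξ, ∀ θ : ℝ → ℂ, (∀ k, 2 * Real.pi * δ ≤ k → ‖θ k‖ ≤ K * weight s k) →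
      ‖superposition A B θ F G ξ‖ ≤
        weight s ξ * (K * (2 * Real.pi) ^ s * (C * (1 + δ⁻¹)) * dataSize F G ξ) := by
  have hC := hA.nonneg
  filter_upwards [hF.ae_superposition_eq_zero_or] with ξ hξ θ hθ
  have hK : 0 ≤ K := nonneg_of_mul_nonneg_left ((norm_nonneg _).trans (hθ _ le_rfl))
    (weight_pos s _)
  have hsize := dataSize_nonneg F G ξ
  rcases hξ with ⟨hsize, hzero⟩ | hξ
  · rw [hzero, hsize, mul_zero, mul_zero, norm_zero]
  calc ‖superposition A B θ F G ξ‖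
      ≤ ‖θ (freq ξ)‖ * (C * (1 + δ⁻¹) * dataSize F G ξ) := norm_superposition_le hA hδ hξ
    _ ≤ K * ((2 * Real.pi) ^ s * weight s ξ) * (C * (1 + δ⁻¹) * dataSize F G ξ) := by
        gcongr
        refine (hθ _ (freq_mono hξ)).trans ?_
        gcongr
        exact weight_freq_le hs ξ
    _ = _ := by ring

theorem ae_norm_weight_mul_superposition_le (hF : IsFourierData δ F G) (hδ : 0 < δ)
    (hA : IsAmplitudePair (2 * Real.pi * δ) C A B) (hs : 0 ≤ s)
    (hθ : ∀ k, 2 * Real.pi * δ ≤ k → ‖θ k‖ ≤ K * weight s k) :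
    ∀ᵐ ξ, ‖weight (-s) ξ * superposition A B θ F G ξ‖ ≤
      K * (2 * Real.pi) ^ s * (C * (1 + δ⁻¹)) * dataSize F G ξ := by
  filter_upwards [hF.ae_norm_superposition_le hδ hA hs] with ξ hξ
  have hw : weight (-s) ξ * weight s ξ = 1 := by
    rw [weight_mul_weight, neg_add_cancel, weight_zero]
  rw [norm_mul, Complex.norm_real, Real.norm_of_nonneg (weight_pos _ ξ).le]
  refine (mul_le_mul_of_nonneg_left (hξ θ hθ) (weight_pos _ ξ).le).trans_eq ?_
  rw [← mul_assoc, hw, one_mul]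

end IsFourierData

end Superposition

section Evolution

variable {E : Type*} [NormedAddCommGroup E] [InnerProductSpace ℝ E] [FiniteDimensional ℝ E]
  [MeasurableSpace E] [BorelSpace E] {δ C K s : ℝ} {A B θ : ℝ → ℂ} {F G : E → ℂ}

namespace IsFourierData

theorem aestronglyMeasurable_snd (hF : IsFourierData δ F G) : AEStronglyMeasurable G := by
  refine ((Complex.continuous_ofReal.comp (continuous_weight (- -1))).aestronglyMeasurable.mul
    hF.memLp_snd.1).congr (ae_of_all _ fun ξ => ?_)
  exact weight_neg_mul_weight_mul (-1) ξ (G ξ)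

theorem aestronglyMeasurable_superposition (hF : IsFourierData δ F G) (hA : Measurable A)
    (hB : Measurable B) (hθ : Measurable θ) : AEStronglyMeasurable (superposition A B θ F G) := by
  have hfreq : Measurable (freq : E → ℝ) := continuous_freq.measurable
  have hre (P : ℝ → ℂ) (hP : Measurable P) :
      AEStronglyMeasurable fun ξ : E => ((θ (freq ξ) * P (freq ξ)).re : ℂ) :=
    (Complex.measurable_ofReal.comp (Complex.measurable_re.comp
      ((hθ.mul hP).comp hfreq))).aestronglyMeasurable
  exact ((hre A hA).mul hF.memLp_fst.1).add ((hre B hB).mul hF.aestronglyMeasurable_snd)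

theorem memLp_weight_mul_superposition (hF : IsFourierData δ F G) (hδ : 0 < δ)
    (hA : IsAmplitudePair (2 * Real.pi * δ) C A B) (hs : 0 ≤ s) (hθm : Measurable θ)
    (hθ : ∀ k, 2 * Real.pi * δ ≤ k → ‖θ k‖ ≤ K * weight s k) :
    MemLp (fun ξ => weight (-s) ξ * superposition A B θ F G ξ) 2 :=
  (hF.memLp_dataSize.const_mul _).mono' ((Complex.continuous_ofReal.comp
    (continuous_weight (-s))).aestronglyMeasurable.mul
      (hF.aestronglyMeasurable_superposition hA.measurable_fst hA.measurable_snd hθm))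
    (hF.ae_norm_weight_mul_superposition_le hδ hA hs hθ)

theorem eLpNorm_weight_mul_superposition_le (hF : IsFourierData δ F G) (hδ : 0 < δ)
    (hA : IsAmplitudePair (2 * Real.pi * δ) C A B) (hs : 0 ≤ s)
    (hθ : ∀ k, 2 * Real.pi * δ ≤ k → ‖θ k‖ ≤ K * weight s k) :
    eLpNorm (fun ξ => weight (-s) ξ * superposition A B θ F G ξ) 2 ≤
      ENNReal.ofReal (K * (2 * Real.pi) ^ s * (C * (1 + δ⁻¹))) *
        (eLpNorm F 2 + eLpNorm (fun ξ => weight (-1) ξ * G ξ) 2) := by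
  refine (eLpNorm_le_mul_eLpNorm_of_ae_le_mul (g := dataSize F G) ?_ 2).trans
    (mul_le_mul_right hF.eLpNorm_dataSize_le _)
  filter_upwards [hF.ae_norm_weight_mul_superposition_le hδ hA hs hθ] with ξ hξ
  rwa [Real.norm_of_nonneg (dataSize_nonneg F G ξ)]

theorem exists_hasDensity_superposition (hF : IsFourierData δ F G) (hδ : 0 < δ)
    (hA : IsAmplitudePair (2 * Real.pi * δ) C A B) (hs : 0 ≤ s) (hθm : Measurable θ)
    (hθ : ∀ k, 2 * Real.pi * δ ≤ k → ‖θ k‖ ≤ K * weight s k) :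
    ∃ T : 𝓢'(E, ℂ), HasDensity T (superposition A B θ F G) := by
  refine exists_hasDensity (s := -s) ?_
  exact hF.memLp_weight_mul_superposition hδ hA hs hθm hθ

theorem exists_hasDensity_weight_mul_dataSize (hF : IsFourierData δ F G) (s c : ℝ) :
    ∃ T : 𝓢'(E, ℂ), HasDensity T fun ξ => ((weight s ξ * (c * dataSize F G ξ) : ℝ) : ℂ) := by
  refine exists_hasDensity (s := -s) ((hF.memLp_dataSize.const_mul c).ofReal.ae_eq
    (ae_of_all _ fun ξ => ?_))
  change ((c * dataSize F G ξ : ℝ) : ℂ) = (weight (-s) ξ : ℂ) * _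
  rw [Complex.ofReal_mul (weight s ξ), weight_neg_mul_weight_mul]

theorem hasDerivAt_apply_superposition (hF : IsFourierData δ F G) (hδ : 0 < δ)
    (hA : IsAmplitudePair (2 * Real.pi * δ) C A B) {D : ℝ → 𝓢'(E, ℂ)} {T : 𝓢'(E, ℂ)}
    {θ θ' : ℝ → ℝ → ℂ} {N : Set ℝ} {t : ℝ} (hN : N ∈ 𝓝 t)
    (hD : ∀ τ ∈ N, HasDensity (D τ) (superposition A B (θ τ) F G))
    (hT : HasDensity T (superposition A B (θ' t) F G)) (hs : 0 ≤ s)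
    (hderiv : ∀ τ ∈ N, ∀ k, 2 * Real.pi * δ ≤ k → HasDerivAt (fun τ => θ τ k) (θ' τ k) τ)
    (hbound : ∀ τ ∈ N, ∀ k, 2 * Real.pi * δ ≤ k → ‖θ' τ k‖ ≤ K * weight s k) (φ : 𝓢(E, ℂ)) :
    HasDerivAt (fun τ => D τ φ) (T φ) t := by
  obtain ⟨S, hS⟩ := hF.exists_hasDensity_weight_mul_dataSize s
    (K * (2 * Real.pi) ^ s * (C * (1 + δ⁻¹)))
  refine HasDensity.hasDerivAt_apply (y' := fun τ => superposition A B (θ' τ) F G) hN hD hT hS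
    ?_ ?_ φ
  · filter_upwards [hF.ae_norm_superposition_le hδ hA hs] with ξ hξ τ hτ
    rw [Complex.norm_real]
    exact (hξ _ (hbound τ hτ)).trans (Real.le_norm_self _)
  · filter_upwards [hF.ae_superposition_eq_zero_or] with ξ hξ τ hτ
    rcases hξ with ⟨-, hzero⟩ | hξ
    · simp only [hzero]
      exact hasDerivAt_const τ 0
    · exact hasDerivAt_superposition (hderiv τ hτ _ (freq_mono hξ))

end IsFourierData

theorem IsMode.exists_isDampedOscillation {b : ℝ → ℝ} {I : Set ℝ} {θ θ₁ : ℝ → ℝ → ℂ}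
    (hθ : IsMode b I (2 * Real.pi * δ) θ θ₁) (hI : IsOpen I) (hb : ContinuousOn b I)
    (hF : IsFourierData δ F G) (hδ : 0 < δ) (hA : IsAmplitudePair (2 * Real.pi * δ) C A B) :
    ∃ D D₁ : ℝ → 𝓢'(E, ℂ),
      (∀ t ∈ I, HasDensity (D t) (superposition A B (θ t) F G)) ∧
      (∀ t ∈ I, HasDensity (D₁ t) (superposition A B (θ₁ t) F G)) ∧
      IsDampedOscillation (fun ξ : E => ((freq ξ ^ 2 : ℝ) : ℂ)) b I D D₁ := by
  have hexists (t : ℝ) : ∃ S S₁ : 𝓢'(E, ℂ), t ∈ I →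
      HasDensity S (superposition A B (θ t) F G) ∧
        HasDensity S₁ (superposition A B (θ₁ t) F G) := by
    by_cases ht : t ∈ I
    · obtain ⟨K, hK⟩ := hθ.exists_bound t ht
      have hK' := hK.self_of_nhds
      obtain ⟨S, hS⟩ := hF.exists_hasDensity_superposition hδ hA le_rfl (hθ.measurable t)
        (K := K) fun k hk => by rw [weight_zero, mul_one]; exact (hK' k hk).1
      obtain ⟨S₁, hS₁⟩ := hF.exists_hasDensity_superposition hδ hA zero_le_one
        (hθ.measurable_deriv t) fun k hk => (hK' k hk).2
      exact ⟨S, S₁, fun _ => ⟨hS, hS₁⟩⟩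
    · exact ⟨0, 0, fun h => absurd h ht⟩
  choose D D₁ hD using hexists
  refine ⟨D, D₁, fun t ht => (hD t ht).1, fun t ht => (hD t ht).2, fun φ t ht => ?_,
    fun φ t ht => ?_⟩
  · obtain ⟨K, hK⟩ := hθ.exists_bound t ht
    exact (hF.hasDerivAt_apply_superposition hδ hA (Filter.inter_mem (hI.mem_nhds ht) hK)
      (fun τ hτ => (hD τ hτ.1).1) (hD t ht).2 zero_le_one (fun τ hτ => hθ.hasDerivAt τ hτ.1)
      (fun τ hτ k hk => (hτ.2 k hk).2) φ).hasDerivWithinAt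
  · obtain ⟨K, hK⟩ := hθ.exists_norm_deriv_deriv_le ht (hb.continuousAt (hI.mem_nhds ht))
    have hT := ((((hD t ht).1.smulLeftCLM hasTemperateGrowth_freq_sq).add
      ((hD t ht).2.smul (b t))).smul (-1))
    rw [← superposition_oscillator_profile] at hT
    refine ((hF.hasDerivAt_apply_superposition hδ hA
      (Filter.inter_mem (hI.mem_nhds ht) hK) (fun τ hτ => (hD τ hτ.1).2) hT zero_le_two
      (fun τ hτ => hθ.hasDerivAt_deriv τ hτ.1) (fun τ hτ k hk => hτ.2 k hk) φ).congr_deriv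
      ?_).hasDerivWithinAt
    exact neg_one_smul ℂ _

end Evolution

section Amplitudes

open ComplexConjugate

/-- The amplitude for which `superposition` of the modes `dampedMode μ f` has initial position `1`
and initial velocity `0`, if `f` is a Jost solution with derivative `f'`. -/
def positionAmplitude (μ : ℝ) (f f' : ℝ → ℂ) (k : ℝ) : ℂ :=
  Complex.I * conj (f' k - (μ / k : ℝ) * f k)

/-- The amplitude for which `superposition` of the modes `dampedMode μ f` has initial position `0`
and initial velocity `1`, if `f` is a Jost solution. -/
def velocityAmplitude (f : ℝ → ℂ) (k : ℝ) : ℂ := -(Complex.I * conj (f k)) / k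

theorem dampedMode_one (μ : ℝ) (f : ℝ → ℂ) (k : ℝ) : dampedMode μ f 1 k = f k := by
  rw [dampedMode, Real.one_rpow, Complex.ofReal_one, one_mul, one_mul]

theorem dampedModeDeriv_one (μ : ℝ) (f f' : ℝ → ℂ) (k : ℝ) :
    dampedModeDeriv μ f f' 1 k = k * f' k - μ * f k := by
  rw [dampedModeDeriv, Real.one_rpow, Complex.ofReal_one, one_mul, one_mul, div_one]

namespace IsJostSolution

variable {c μ κ k : ℝ} {f f' : ℝ → ℂ}

theorem im_mul_conj_eq (hf : IsJostSolution c f f') (hk : 0 < k) :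
    (f k * conj (f' k)).im = -1 := by
  have h := congrArg Complex.im (hf.wronskian_eq hk)
  simp only [Complex.sub_im, Complex.mul_im, Complex.conj_re, Complex.conj_im, Complex.neg_re,
    Complex.neg_im, Complex.re_ofNat, Complex.im_ofNat, Complex.I_re, Complex.I_im] at h ⊢
  linarith

theorem exists_isAmplitudePair (hf : IsJostSolution c f f') (μ : ℝ) (hκ : 0 < κ) :
    ∃ C, IsAmplitudePair κ C (positionAmplitude μ f f') (velocityAmplitude f) := by
  obtain ⟨C, hC⟩ := hf.exists_norm_le hκ
  have hC0 : 0 ≤ C := (norm_nonneg _).trans (hC κ le_rfl).1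
  refine ⟨C + |μ| / κ * C, ?_, ?_, fun k hk => ?_, fun k hk => ?_⟩
  · exact (Complex.continuous_conj.measurable.comp (hf.measurable_deriv.sub
      ((Complex.measurable_ofReal.comp (measurable_const.div measurable_id)).mul
        hf.measurable))).const_mul _
  · exact ((Complex.continuous_conj.measurable.comp hf.measurable).const_mul _).neg.div
      Complex.measurable_ofReal
  · obtain ⟨hfC, hfC'⟩ := hC k hk
    have hdiv : ‖((μ / k : ℝ) : ℂ)‖ ≤ |μ| / κ := by
      rw [Complex.norm_real, norm_div, Real.norm_of_nonneg (hκ.le.trans hk), Real.norm_eq_abs]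
      gcongr
    rw [positionAmplitude, norm_mul, Complex.norm_I, one_mul, Complex.norm_conj]
    refine (norm_sub_le _ _).trans (add_le_add hfC' ?_)
    rw [norm_mul]
    gcongr
  · have hk0 : 0 ≤ k := hκ.le.trans hk
    rw [velocityAmplitude, norm_div, norm_neg, norm_mul, Complex.norm_I, one_mul,
      Complex.norm_conj, Complex.norm_real, Real.norm_of_nonneg hk0]
    gcongr
    exact (hC k hk).1.trans (le_add_of_nonneg_right (by positivity))

variable {E : Type*} [NormedAddCommGroup E] {ξ : E}

theorem superposition_dampedMode_one (hf : IsJostSolution c f f') (μ : ℝ) (F G : E → ℂ)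
    (hξ : 0 < freq ξ) :
    superposition (positionAmplitude μ f f') (velocityAmplitude f) (dampedMode μ f 1) F G ξ =
      F ξ := by
  have hW := hf.im_mul_conj_eq hξ
  have hposition : (f (freq ξ) * positionAmplitude μ f f' (freq ξ)).re = 1 := by
    simp only [positionAmplitude, Complex.mul_re, Complex.mul_im, Complex.I_re, Complex.I_im,
      Complex.conj_re, Complex.conj_im, Complex.sub_re, Complex.sub_im, Complex.ofReal_re,
      Complex.ofReal_im] at hW ⊢
    linear_combination -hW
  have hvelocity : (f (freq ξ) * velocityAmplitude f (freq ξ)).re = 0 := by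
    rw [velocityAmplitude, ← mul_div_assoc, Complex.div_ofReal_re]
    simp only [Complex.mul_re, Complex.mul_im, Complex.neg_re, Complex.neg_im, Complex.I_re,
      Complex.I_im, Complex.conj_re, Complex.conj_im]
    ring
  rw [superposition, dampedMode_one, hposition, hvelocity, Complex.ofReal_one, Complex.ofReal_zero,
    one_mul, zero_mul, add_zero]

theorem superposition_dampedModeDeriv_one (hf : IsJostSolution c f f') (μ : ℝ) (F G : E → ℂ)
    (hξ : 0 < freq ξ) :
    superposition (positionAmplitude μ f f') (velocityAmplitude f) (dampedModeDeriv μ f f' 1) F G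
      ξ = G ξ := by
  have hk := hξ.ne'
  have hW := hf.im_mul_conj_eq hξ
  have hposition : ((freq ξ * f' (freq ξ) - μ * f (freq ξ)) *
      positionAmplitude μ f f' (freq ξ)).re = 0 := by
    simp only [positionAmplitude, Complex.mul_re, Complex.mul_im, Complex.I_re, Complex.I_im,
      Complex.conj_re, Complex.conj_im, Complex.sub_re, Complex.sub_im, Complex.ofReal_re,
      Complex.ofReal_im]
    field_simp
    ring
  have hvelocity : ((freq ξ * f' (freq ξ) - μ * f (freq ξ)) *
      velocityAmplitude f (freq ξ)).re = 1 := by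
    rw [velocityAmplitude, ← mul_div_assoc, Complex.div_ofReal_re, div_eq_one_iff_eq hk]
    simp only [Complex.mul_re, Complex.mul_im, Complex.I_re, Complex.I_im, Complex.neg_re,
      Complex.neg_im, Complex.conj_re, Complex.conj_im, Complex.sub_re, Complex.sub_im,
      Complex.ofReal_re, Complex.ofReal_im] at hW ⊢
    linear_combination -freq ξ * hW
  rw [superposition, dampedModeDeriv_one, hposition, hvelocity, Complex.ofReal_one,
    Complex.ofReal_zero, one_mul, zero_mul, zero_add]

end IsJostSolution

end Amplitudes

section CauchyData

variable {n : ℕ} {δ : ℝ} {d d' w w' : 𝓢'(Space n, ℂ) × 𝓢'(Space n, ℂ)} {F G F' G' : Space n → ℂ}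

/-- The Fourier transforms of the two components of the Cauchy data `d` are the functions `F` and
`G`. -/
structure HasFourierDensities (d : 𝓢'(Space n, ℂ) × 𝓢'(Space n, ℂ)) (F G : Space n → ℂ) :
    Prop where
  fst : HasDensity (𝓕 d.1) F
  snd : HasDensity (𝓕 d.2) G

namespace HasFourierDensities

theorem ext (h : HasFourierDensities w F G) (h' : HasFourierDensities w' F G) : w = w' :=
  Prod.ext ((FourierTransform.fourierEquiv ℂ 𝓢'(Space n, ℂ)).injective (h.fst.ext h'.fst))
    ((FourierTransform.fourierEquiv ℂ 𝓢'(Space n, ℂ)).injective (h.snd.ext h'.snd))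

theorem add (h : HasFourierDensities d F G) (h' : HasFourierDensities d' F' G') :
    HasFourierDensities (d + d') (F + F') (G + G') where
  fst := (FourierTransform.fourier_add d.1 d'.1).symm ▸ h.fst.add h'.fst
  snd := (FourierTransform.fourier_add d.2 d'.2).symm ▸ h.snd.add h'.snd

theorem smul (h : HasFourierDensities d F G) (c : ℂ) :
    HasFourierDensities (c • d) (c • F) (c • G) where
  fst := (FourierTransform.fourier_smul c d.1).symm ▸ h.fst.smul c
  snd := (FourierTransform.fourier_smul c d.2).symm ▸ h.snd.smul c

theorem l2Norm_eq_and_sobolevNorm_eq (h : HasFourierDensities d F G) (hF : IsFourierData δ F G) :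
    l2Norm d.1 = eLpNorm F 2 ∧
      sobolevNorm (-1) d.2 = eLpNorm (fun ξ => weight (-1) ξ * G ξ) 2 :=
  ⟨l2Norm_eq_eLpNorm h.fst hF.memLp_fst, sobolevNorm_eq_eLpNorm h.snd hF.memLp_snd⟩

end HasFourierDensities

theorem exists_isFourierData (d : admissibleData n)
    (hδ : ∀ ξ ∈ fourierSupport d.1.1 ∪ fourierSupport d.1.2, δ ≤ ‖ξ‖) :
    ∃ F G, HasFourierDensities d.1 F G ∧ IsFourierData δ F G := by
  obtain ⟨F, hF, hdF⟩ := exists_fourier_hasDensity d.2.1.1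
  obtain ⟨G, hG, hdG⟩ := exists_fourier_hasDensity d.2.1.2
  refine ⟨F, G, ⟨hdF, hdG⟩, ?_, hG, ?_⟩
  · simpa only [weight_zero, Complex.ofReal_one, one_mul] using hF
  · filter_upwards [hdF.ae_mem_dsupport, hdG.ae_mem_dsupport] with ξ hFξ hGξ hξ
    exact hδ ξ (hξ.imp hFξ hGξ)

theorem exists_pos_isFourierData (d : admissibleData n) :
    ∃ δ : ℝ, 0 < δ ∧ ∃ F G, HasFourierDensities d.1 F G ∧ IsFourierData δ F G := by
  have hclosed : IsClosed (fourierSupport d.1.1 ∪ fourierSupport d.1.2) :=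
    Distribution.isClosed_dsupport.union Distribution.isClosed_dsupport
  obtain ⟨δ, hδ, hball⟩ := Metric.isOpen_iff.1 hclosed.isOpen_compl 0
    (Set.mem_compl fun h => h.elim d.2.2.1 d.2.2.2)
  exact ⟨δ, hδ, exists_isFourierData d fun ξ hξ =>
    not_lt.1 fun hlt => hball (mem_ball_zero_iff.2 hlt) hξ⟩

end CauchyData

section WaveOperator

variable {n : ℕ} {μ δ C K s : ℝ} {A B θ : ℝ → ℂ} {f f' : ℝ → ℂ} {F G : Space n → ℂ}
  {d : 𝓢'(Space n, ℂ) × 𝓢'(Space n, ℂ)}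
  {W : admissibleData n →ₗ[ℂ] 𝓢'(Space n, ℂ) × 𝓢'(Space n, ℂ)}

/-- `W` maps Cauchy data to the value at time `1` of the free wave with amplitudes `A` and `B`. -/
def IsWaveOperator (A B : ℝ → ℂ)
    (W : admissibleData n →ₗ[ℂ] 𝓢'(Space n, ℂ) × 𝓢'(Space n, ℂ)) : Prop :=
  ∀ d F G, HasFourierDensities d.1 F G → HasFourierDensities (W d)
    (superposition A B (freeMode 1) F G) (superposition A B (freeModeDeriv 1) F G)

theorem HasFourierDensities.sobolevNorm_superposition_le (h : HasFourierDensities d F G)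
    (hF : IsFourierData δ F G) (hδ : 0 < δ)
    (hA : IsAmplitudePair (2 * Real.pi * δ) C A B) (hs : 0 ≤ s) (hθm : Measurable θ)
    (hθ : ∀ k, 2 * Real.pi * δ ≤ k → ‖θ k‖ ≤ K * weight s k) {w : 𝓢'(Space n, ℂ)}
    (hw : HasDensity (𝓕 w) (superposition A B θ F G)) :
    sobolevNorm (-s) w ≤ ENNReal.ofReal (K * (2 * Real.pi) ^ s * (C * (1 + δ⁻¹))) *
      (l2Norm d.1 + sobolevNorm (-1) d.2) := by
  obtain ⟨hnorm₀, hnorm₁⟩ := h.l2Norm_eq_and_sobolevNorm_eq hF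
  rw [sobolevNorm_eq_eLpNorm hw (hF.memLp_weight_mul_superposition hδ hA hs hθm hθ), hnorm₀,
    hnorm₁]
  exact hF.eLpNorm_weight_mul_superposition_le hδ hA hs hθ

theorem HasFourierDensities.l2Norm_superposition_le (h : HasFourierDensities d F G)
    (hF : IsFourierData δ F G) (hδ : 0 < δ)
    (hA : IsAmplitudePair (2 * Real.pi * δ) C A B) (hθm : Measurable θ)
    (hθ : ∀ k, 2 * Real.pi * δ ≤ k → ‖θ k‖ ≤ K) {w : 𝓢'(Space n, ℂ)}
    (hw : HasDensity (𝓕 w) (superposition A B θ F G)) :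
    l2Norm w ≤ ENNReal.ofReal (K * (C * (1 + δ⁻¹))) * (l2Norm d.1 + sobolevNorm (-1) d.2) := by
  have hle := h.sobolevNorm_superposition_le hF hδ hA le_rfl hθm (K := K)
    (fun k hk => by rw [weight_zero, mul_one]; exact hθ k hk) hw
  rwa [neg_zero, sobolevNorm, TemperedDistribution.besselPotential_zero, Real.rpow_zero,
    mul_one] at hle

theorem exists_hasFourierDensities_superposition (hA : ∀ κ, 0 < κ → ∃ C, IsAmplitudePair κ C A B)
    (d : admissibleData n) : ∃ w : 𝓢'(Space n, ℂ) × 𝓢'(Space n, ℂ), ∀ F G,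
      HasFourierDensities d.1 F G → HasFourierDensities w
        (superposition A B (freeMode 1) F G) (superposition A B (freeModeDeriv 1) F G) := by
  obtain ⟨δ, hδ, F, G, hd, hF⟩ := exists_pos_isFourierData d
  obtain ⟨C, hC⟩ := hA (2 * Real.pi * δ) (by positivity)
  obtain ⟨D, D₁, hD, hD₁, -⟩ := (isMode_freeMode (2 * Real.pi * δ)).exists_isDampedOscillation
    isOpen_univ continuousOn_const hF hδ hC
  refine ⟨(𝓕⁻ (D 1), 𝓕⁻ (D₁ 1)), fun F' G' hd' => ?_⟩
  have hFF' := hd.fst.ae_eq hd'.fst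
  have hGG' := hd.snd.ae_eq hd'.snd
  constructor <;> rw [FourierTransform.fourier_fourierInv_eq]
  · exact (hD 1 trivial).congr (superposition_congr_data hFF' hGG')
  · exact (hD₁ 1 trivial).congr (superposition_congr_data hFF' hGG')

theorem exists_isWaveOperator (hA : ∀ κ, 0 < κ → ∃ C, IsAmplitudePair κ C A B) :
    ∃ W : admissibleData n →ₗ[ℂ] 𝓢'(Space n, ℂ) × 𝓢'(Space n, ℂ), IsWaveOperator A B W := by
  choose W hW using exists_hasFourierDensities_superposition (n := n) hA
  refine ⟨⟨⟨W, fun d d' => ?_⟩, fun c d => ?_⟩, hW⟩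
  · obtain ⟨-, -, F, G, hd, -⟩ := exists_pos_isFourierData d
    obtain ⟨-, -, F', G', hd', -⟩ := exists_pos_isFourierData d'
    have h := hW (d + d') _ _ (hd.add hd')
    rw [superposition_add_data, superposition_add_data] at h
    exact h.ext ((hW d F G hd).add (hW d' F' G' hd'))
  · obtain ⟨-, -, F, G, hd, -⟩ := exists_pos_isFourierData d
    have h := hW (c • d) _ _ (hd.smul c)
    rw [superposition_smul_data, superposition_smul_data] at h
    exact h.ext ((hW d F G hd).smul c)

namespace IsWaveOperator

theorem exists_norm_le (hW : IsWaveOperator A B W) (hδ : 0 < δ)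
    (hA : IsAmplitudePair (2 * Real.pi * δ) C A B) :
    ∃ M : ℝ≥0, ∀ d : admissibleData n,
      (∀ ξ ∈ fourierSupport d.1.1 ∪ fourierSupport d.1.2, δ ≤ ‖ξ‖) →
      l2Norm (W d).1 + sobolevNorm (-1) (W d).2 ≤
        M * (l2Norm d.1.1 + sobolevNorm (-1) d.1.2) := by
  refine ⟨(1 * (C * (1 + δ⁻¹))).toNNReal +
    (1 * (2 * Real.pi) ^ (1 : ℝ) * (C * (1 + δ⁻¹))).toNNReal, fun d hd => ?_⟩
  obtain ⟨F, G, hFG, hF⟩ := exists_isFourierData d hd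
  have hw := hW d F G hFG
  have hfree := isMode_freeMode (2 * Real.pi * δ)
  have hposition := hFG.l2Norm_superposition_le hF hδ hA (hfree.measurable 1)
    (fun k _ => (norm_freeMode 1 k).le) hw.fst
  have hvelocity := hFG.sobolevNorm_superposition_le hF hδ hA zero_le_one
    (hfree.measurable_deriv 1)
    (fun k _ => (norm_freeModeDeriv_le 1 k).trans_eq (one_mul _).symm) hw.snd
  refine (add_le_add hposition hvelocity).trans_eq ?_
  rw [← add_mul, ENNReal.ofReal, ENNReal.ofReal, ENNReal.coe_add]

theorem exists_freeWave (hW : IsWaveOperator A B W) (hδ : 0 < δ)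
    (hA : IsAmplitudePair (2 * Real.pi * δ) C A B) (hF : IsFourierData δ F G)
    {d : admissibleData n} (hd : HasFourierDensities d.1 F G) :
    ∃ w, SolvesCauchyProblem (fun _ => 0) Set.univ w (W d).1 (W d).2 ∧
      ∀ t, HasDensity (𝓕 (w t)) (superposition A B (freeMode t) F G) := by
  obtain ⟨D, D₁, hD, hD₁, hosc⟩ := (isMode_freeMode _).exists_isDampedOscillation
    isOpen_univ continuousOn_const hF hδ hA
  have hWd : (𝓕⁻ (D 1), 𝓕⁻ (D₁ 1)) = W d := by
    refine HasFourierDensities.ext ⟨?_, ?_⟩ (hW d F G hd) <;>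
      rw [FourierTransform.fourier_fourierInv_eq]
    exacts [hD 1 trivial, hD₁ 1 trivial]
  refine ⟨fun t => 𝓕⁻ (D t), ?_, fun t => ?_⟩
  · rw [← hWd]
    exact hosc.solvesCauchyProblem_fourierInv continuousOn_const
  · rw [FourierTransform.fourier_fourierInv_eq]
    exact hD t trivial

end IsWaveOperator

namespace IsJostSolution

theorem superposition_dampedMode_one_ae_eq (hf : IsJostSolution (μ - μ ^ 2) f f')
    (hF : IsFourierData δ F G) (hδ : 0 < δ) :
    superposition (positionAmplitude μ f f') (velocityAmplitude f) (dampedMode μ f 1) F G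
        =ᵐ[volume] F ∧
      superposition (positionAmplitude μ f f') (velocityAmplitude f) (dampedModeDeriv μ f f' 1) F G
        =ᵐ[volume] G := by
  have hae : ∀ᵐ ξ, (F ξ = 0 ∧ G ξ = 0) ∨ 0 < freq ξ := by
    filter_upwards [hF.ae_le_norm] with ξ hξ
    by_contra! h
    have hle := freq_mono (hξ (not_and_or.1 fun hFG => h.1 hFG.1 hFG.2))
    exact (h.2.trans_lt (by positivity : 0 < 2 * Real.pi * δ)).not_ge hle
  constructor <;> filter_upwards [hae] with ξ hξ <;> rcases hξ with ⟨hFξ, hGξ⟩ | hξ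
  · rw [superposition, hFξ, hGξ, mul_zero, mul_zero, add_zero]
  · exact hf.superposition_dampedMode_one μ F G hξ
  · rw [superposition, hFξ, hGξ, mul_zero, mul_zero, add_zero]
  · exact hf.superposition_dampedModeDeriv_one μ F G hξ

theorem hasDensity_fourier_of_solvesCauchyProblem (hf : IsJostSolution (μ - μ ^ 2) f f')
    (hδ : 0 < δ)
    (hA : IsAmplitudePair (2 * Real.pi * δ) C (positionAmplitude μ f f') (velocityAmplitude f))
    (hF : IsFourierData δ F G) (hd : HasFourierDensities d F G) {u : ℝ → 𝓢'(Space n, ℂ)}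
    (hu : SolvesCauchyProblem (fun t => 2 * μ / t) (Set.Ici 1) u d.1 d.2) {t : ℝ} (ht : 1 ≤ t) :
    HasDensity (𝓕 (u t)) (superposition (positionAmplitude μ f f') (velocityAmplitude f)
      (dampedMode μ f t) F G) := by
  have hsub : Set.Ici (1 : ℝ) ⊆ Set.Ioi 0 := Set.Ici_subset_Ioi.2 one_pos
  have hone_mem : (1 : ℝ) ∈ Set.Ioi 0 := Set.mem_Ioi.2 one_pos
  have hb : ContinuousOn (fun t => 2 * μ / t) (Set.Ioi 0) :=
    continuousOn_const.div continuousOn_id fun s hs => ne_of_gt hs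
  obtain ⟨D, D₁, hD, hD₁, hosc⟩ := (hf.isMode_dampedMode (by positivity)).exists_isDampedOscillation
    isOpen_Ioi hb hF hδ hA
  obtain ⟨ut, hu₀, hu₁, hfourier⟩ := exists_isDampedOscillation_fourier hu
  obtain ⟨hone, hone₁⟩ := hf.superposition_dampedMode_one_ae_eq hF hδ
  have hinit : 𝓕 (u 1) = D 1 := hu₀ ▸ hd.fst.ext ((hD 1 hone_mem).congr hone)
  have hinit₁ : 𝓕 (ut 1) = D₁ 1 := hu₁ ▸ hd.snd.ext ((hD₁ 1 hone_mem).congr hone₁)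
  have heq : 𝓕 (u t) = D t := hfourier.eq_of_eq_initial hasTemperateGrowth_freq_sq
    (hb.mono hsub) (hosc.mono hsub) hinit hinit₁ ht
  exact heq ▸ hD t (hsub ht)

end IsJostSolution

theorem IsWaveOperator.exists_l2Norm_rpow_smul_sub_freeWave_le
    (hW : IsWaveOperator (positionAmplitude μ f f') (velocityAmplitude f) W)
    (hf : IsJostSolution (μ - μ ^ 2) f f') (hδ : 0 < δ)
    (hA : IsAmplitudePair (2 * Real.pi * δ) C (positionAmplitude μ f f') (velocityAmplitude f)) :
    ∃ M : ℝ≥0, ∀ d : admissibleData n,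
      (∀ ξ ∈ fourierSupport d.1.1 ∪ fourierSupport d.1.2, δ ≤ ‖ξ‖) →
      ∃ w, SolvesCauchyProblem (fun _ => 0) Set.univ w (W d).1 (W d).2 ∧
        ∀ u, SolvesCauchyProblem (fun t => 2 * μ / t) (Set.Ici 1) u d.1.1 d.1.2 →
          ∀ t : ℝ, 1 ≤ t → l2Norm (((t ^ μ : ℝ) : ℂ) • u t - w t) ≤
            M * ENNReal.ofReal t⁻¹ * (l2Norm d.1.1 + sobolevNorm (-1) d.1.2) := by
  have hκ : 0 < 2 * Real.pi * δ := by positivity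
  obtain ⟨K, hK⟩ := hf.exists_norm_rpow_mul_dampedMode_sub_freeMode_le hκ
  refine ⟨(K * (C * (1 + δ⁻¹))).toNNReal, fun d hsupp => ?_⟩
  obtain ⟨F, G, hd, hF⟩ := exists_isFourierData d hsupp
  obtain ⟨w, hw, hwt⟩ := hW.exists_freeWave hδ hA hF hd
  refine ⟨w, hw, fun u hu t ht => ?_⟩
  have hsub : 𝓕 (((t ^ μ : ℝ) : ℂ) • u t - w t) = 𝓕 (((t ^ μ : ℝ) : ℂ) • u t) - 𝓕 (w t) :=
    map_sub (FourierTransform.fourierEquiv ℂ 𝓢'(Space n, ℂ)) _ _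
  have hdensity := ((hf.hasDensity_fourier_of_solvesCauchyProblem hδ hA hF hd hu ht).smul
    (t ^ μ : ℝ)).sub (hwt t)
  rw [← superposition_ofReal_mul_profile, ← superposition_sub_profile,
    ← FourierTransform.fourier_smul, ← hsub] at hdensity
  have hmeas : Measurable ((fun k => ((t ^ μ : ℝ) : ℂ) * dampedMode μ f t k) - freeMode t) :=
    (((hf.isMode_dampedMode hκ).measurable t).const_mul _).sub ((isMode_freeMode 0).measurable t)
  refine (hd.l2Norm_superposition_le hF hδ hA hmeas (hK t ht) hdensity).trans_eq ?_
  rw [mul_right_comm K, ENNReal.ofReal_mul' (by positivity)]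
  rfl

end WaveOperator

end WeakDamping

end

theorem mainTheorem11 (n : ℕ) (μ : ℝ) :
    ∃ W : WeakDamping.admissibleData n →ₗ[ℂ]
        𝓢'(WeakDamping.Space n, ℂ) × 𝓢'(WeakDamping.Space n, ℂ),
      ∀ ε : ℝ, 0 < ε → ∃ C : ℝ≥0, ∀ d : WeakDamping.admissibleData n,
        (∀ ξ ∈ WeakDamping.fourierSupport d.1.1 ∪ WeakDamping.fourierSupport d.1.2, ε ≤ ‖ξ‖) →
        (WeakDamping.l2Norm (W d).1 + WeakDamping.sobolevNorm (-1) (W d).2 ≤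
          C * (WeakDamping.l2Norm d.1.1 + WeakDamping.sobolevNorm (-1) d.1.2)) ∧
        ∃ w : ℝ → 𝓢'(WeakDamping.Space n, ℂ),
          WeakDamping.SolvesCauchyProblem (fun _ => 0) Set.univ w (W d).1 (W d).2 ∧
          ∀ u : ℝ → 𝓢'(WeakDamping.Space n, ℂ),
            WeakDamping.SolvesCauchyProblem (fun t => 2 * μ / t) (Set.Ici 1) u d.1.1 d.1.2 →
            ∀ t : ℝ, 1 ≤ t →
              WeakDamping.l2Norm (((t ^ μ : ℝ) : ℂ) • u t - w t) ≤
                C * ENNReal.ofReal t⁻¹ *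
                  (WeakDamping.l2Norm d.1.1 + WeakDamping.sobolevNorm (-1) d.1.2) := by
  obtain ⟨f, f', hf⟩ := WeakDamping.exists_isJostSolution (μ - μ ^ 2)
  obtain ⟨W, hW⟩ := WeakDamping.exists_isWaveOperator (n := n) fun _ => hf.exists_isAmplitudePair μ
  refine ⟨W, fun ε hε => ?_⟩
  obtain ⟨C, hC⟩ := hf.exists_isAmplitudePair μ (by positivity : 0 < 2 * Real.pi * ε)
  obtain ⟨M, hM⟩ := hW.exists_norm_le hε hC
  obtain ⟨N, hN⟩ := hW.exists_l2Norm_rpow_smul_sub_freeWave_le hf hε hC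
  refine ⟨max M N, fun d hd => ⟨(hM d hd).trans ?_, ?_⟩⟩
  · gcongr
    exact le_max_left M N
  · obtain ⟨w, hw, hdecay⟩ := hN d hd
    refine ⟨w, hw, fun u hu t ht => (hdecay u hu t ht).trans ?_⟩
    gcongr
    exact le_max_right M N
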